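/- Let $\Theta\subset\mathbb R^{d}$ be compact, let $P_Z$ be a probability measure on a measurable space $\mathcal Z$, and let $\tau(\theta,\cdot):\mathcal Z\to\mathbb R^p$ be measurable for every $\theta\in\Theta$. Suppose there is an integrable $L:\mathcal Z\to\mathbb R$ such that, for $P_Z$-almost every $z$, \[\|\tau(\theta_1,z)-\tau(\theta_2,z)\|\le L(z)\,\|\theta_1-\theta_2\|\qquad\text{for all }\theta_1,\theta_2\in\Theta,\] and that, for $Z\sim P_Z$, the vectors $\tau(\theta,Z)$ are sub-Gaussian uniformly over $\Theta$: \[\sup_{\theta\in\Theta}\ \sup_{\|\omega\|=1}\big\|\omega^{T}\tau(\theta,Z)\big\|_{\psi_2}<\infty,\qquad \|Y\|_{\psi_2}:=\inf\{K>0:\ \mathbb E\exp(Y^2/K^2)\le 2\}.\] Let $P_\theta$ be the law of $\tau(\theta,Z)$ and, for $Z_1,\dots,Z_m$ i.i.d. from $P_Z$, let $Q_m^\theta=\frac1m\sum_{j=1}^m\delta_{\tau(\theta,Z_j)}$. Let \[d_{\mathrm{SW}}(\mu,\nu)=\int_{\mathbb S^{p-1}}W_1(\mu_\omega,\nu_\omega)\,d\sigma(\omega),\]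 where $\sigma$ is the uniform probability measure on the unit sphere, $\mu_\omega,\nu_\omega$ are the images of $\mu,\nu$ under $x\mapsto\omega^{T}x$, and $W_1$ is the 1-Wasserstein distance on $\mathbb R$. Then \[\sup_{\theta\in\Theta}d_{\mathrm{SW}}(Q_m^\theta,P_\theta)=O_p(m^{-1/2}),\] that is, for every $\varepsilon>0$ there is $C<\infty$ such that for all $m\ge1$ the (outer) probability that $\sup_{\theta\in\Theta}d_{\mathrm{SW}}(Q_m^\theta,P_\theta)>C\,m^{-1/2}$ is at most $\varepsilon$. -/

import Mathlib

open MeasureTheory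
open scoped ENNReal NNReal

noncomputable section

namespace SlicedW

/-- The 1-Wasserstein distance of two measures on the line: the infimum of the transport cost
`∫ |x - y| dπ` over all couplings `π`. -/
def wasserstein1 (μ ν : Measure ℝ) : ℝ≥0∞ :=
  ⨅ (π : Measure (ℝ × ℝ)) (_ : π.fst = μ ∧ π.snd = ν), ∫⁻ q, ENNReal.ofReal |q.1 - q.2| ∂π

/-- The uniform probability measure on the unit sphere of `ℝ^p`
(normalized surface measure). -/
def sphereUniform (p : ℕ) : Measure (Metric.sphere (0 : EuclideanSpace ℝ (Fin p)) 1) :=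
  ((volume : Measure (EuclideanSpace ℝ (Fin p))).toSphere Set.univ)⁻¹ •
    (volume : Measure (EuclideanSpace ℝ (Fin p))).toSphere

/-- The law of `⟨ω, X⟩` for `X` of law `μ`. -/
def proj {p : ℕ} (μ : Measure (EuclideanSpace ℝ (Fin p))) (ω : EuclideanSpace ℝ (Fin p)) :
    Measure ℝ :=
  μ.map (fun x => inner ℝ ω x)

/-- The sliced 1-Wasserstein distance. -/
def slicedW {p : ℕ} (μ ν : Measure (EuclideanSpace ℝ (Fin p))) : ℝ≥0∞ :=
  ∫⁻ ω, wasserstein1 (proj μ ω) (proj ν ω) ∂(sphereUniform p)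

/-- The sub-Gaussian norm `inf {K > 0 : E exp (Y² / K²) ≤ 2}` of a real random variable `Y` of
law `ν`; it is `∞` if `Y` is not sub-Gaussian. -/
def psi2Norm (ν : Measure ℝ) : ℝ≥0∞ :=
  ⨅ (K : ℝ≥0) (_ : 0 < K ∧ ∫⁻ y, ENNReal.ofReal (Real.exp (y ^ 2 / (K : ℝ) ^ 2)) ∂ν ≤ 2),
    (K : ℝ≥0∞)

/-- The sub-Gaussian norm of a random vector of law `μ`: the supremum of the sub-Gaussian norms
of its projections on unit directions. -/
def psi2NormVec {p : ℕ} (μ : Measure (EuclideanSpace ℝ (Fin p))) : ℝ≥0∞ :=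
  ⨆ ω : Metric.sphere (0 : EuclideanSpace ℝ (Fin p)) 1, psi2Norm (proj μ ω)

/-- The empirical measure `m⁻¹ ∑ⱼ δ_{x j}`. -/
def empirical {p m : ℕ} (x : Fin m → EuclideanSpace ℝ (Fin p)) :
    Measure (EuclideanSpace ℝ (Fin p)) :=
  (m : ℝ≥0∞)⁻¹ • ∑ j, Measure.dirac (x j)

/-- `X m = O_p(a m)`: for every `ε > 0` there is a finite `C` such that
`P(X m > C * a m) ≤ ε` for all `m ≥ 1`. The variable `X m` may live on its own probability
space; on a set that is not measurable, `μ m` is the outer probability. -/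
def IsBigOp {Ω : ℕ → Type*} [∀ m, MeasurableSpace (Ω m)] (μ : ∀ m, Measure (Ω m))
    (X : ∀ m, Ω m → ℝ≥0∞) (a : ℕ → ℝ) : Prop :=
  ∀ ε : ℝ, 0 < ε → ∃ C : ℝ, 0 < C ∧ ∀ m : ℕ, 1 ≤ m →
    μ m {z | ENNReal.ofReal (C * a m) < X m z} ≤ ENNReal.ofReal ε

end SlicedW

end

/-!
On the line, `W₁` is at most the `L¹` distance of the distribution functions (transport by
quantiles), so the sliced distance is at most the `L¹` norm, over the half-spaces
`{v | ⟨ω, v⟩ ≤ t}`, of the deviation of empirical from true half-space probabilities.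

Consider the difference of two such deviations, for random vectors `T` and `T'` with exponential
moments and `E ‖T - T'‖ ≤ β⁴`. Its `L¹` norm has mean `O(β m^{-1/2})`: the variance of each
half-space term is integrated against the weight `1 + t²`, whose reciprocal is integrable.
Replacing the sample point `x` by `y` changes the norm by at most `m⁻¹ (g x + g y)` with
`g = ‖T - T'‖`, so conditioning on the coordinates one at a time, as in the bounded differences
inequality but with exponential moments of `g` in place of bounds, shows that `√m / β` times the
norm has a bounded exponential moment. The exponential weights cost a power: by the AM-GM
inequality, the weighted moments of `g` are only of order `β²` when its first moment is `β⁴`.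

Chaining along `16⁻ᵏ`-nets of `Θ`, whose links have scale `β` of order `2⁻ᵏ` and whose cardinality
has logarithm of order `k + 1`, bounds the mean of the supremum over the net of level `n` by a
constant times `m^{-1/2}`. The exponential moment is available only for `m^{-1/2} ≲ β`, hence the
chain stops at `2ⁿ ≈ √m`; at that level the Lipschitz envelope accounts for the rest of `Θ`.
Markov's inequality concludes.
-/

noncomputable section

namespace SlicedW

section ExponentialMoments

lemma exp_le_one_add_add_sq_mul_exp_abs (y : ℝ) :
    Real.exp y ≤ 1 + y + y ^ 2 * Real.exp |y| := by
  have h := Complex.norm_exp_sub_sum_le_norm_mul_exp (y : ℂ) 2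
  have hcast : (Complex.exp (y : ℂ) - ∑ m ∈ Finset.range 2, (y : ℂ) ^ m / (m.factorial : ℂ))
      = ((Real.exp y - (1 + y) : ℝ) : ℂ) := by
    simp [Finset.sum_range_succ]
  rw [hcast, Complex.norm_real, Complex.norm_real, Real.norm_eq_abs, Real.norm_eq_abs,
    sq_abs] at h
  linarith [le_abs_self (Real.exp y - (1 + y))]

lemma monotoneOn_sq_mul_exp : MonotoneOn (fun t : ℝ => t ^ 2 * Real.exp t) (Set.Ici 0) := by
  intro s (hs : 0 ≤ s) t _ hst
  dsimp only
  gcongr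

lemma convexOn_sq_mul_exp : ConvexOn ℝ (Set.Ici 0) fun t : ℝ => t ^ 2 * Real.exp t :=
  (convexOn_pow 2).mul (convexOn_exp.subset (Set.subset_univ _) (convex_Ici 0))
    (fun _ _ => sq_nonneg _) (fun _ _ => (Real.exp_pos _).le)
    ((pow_left_monotoneOn (n := 2)).monovaryOn (Real.exp_monotone.monotoneOn _))

variable {α : Type*} [MeasurableSpace α] {P : Measure α} [IsProbabilityMeasure P]

lemma integrable_of_abs_sub_le {Y g : α → ℝ} (hY : AEStronglyMeasurable Y P)
    (hg : Integrable g P) (hosc : ∀ x y, |Y x - Y y| ≤ g x + g y) : Integrable Y P := by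
  obtain ⟨x₀⟩ : Nonempty α := nonempty_of_isProbabilityMeasure P
  refine (hg.add (integrable_const (g x₀ + |Y x₀|))).mono' hY (.of_forall fun x => ?_)
  have := abs_sub_abs_le_abs_sub (Y x) (Y x₀)
  simp only [Pi.add_apply, Real.norm_eq_abs]
  linarith [hosc x x₀]

lemma abs_sub_integral_le {Y g : α → ℝ} (hY : Integrable Y P) (hg : Integrable g P)
    (hosc : ∀ x y, |Y x - Y y| ≤ g x + g y) (x : α) :
    |Y x - ∫ y, Y y ∂P| ≤ g x + ∫ y, g y ∂P := by
  calc |Y x - ∫ y, Y y ∂P| = |∫ y, (Y x - Y y) ∂P| := by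
        rw [integral_sub (integrable_const _) hY]; simp
    _ ≤ ∫ y, |Y x - Y y| ∂P := abs_integral_le_integral_abs
    _ ≤ ∫ y, (g x + g y) ∂P :=
        integral_mono ((integrable_const _).sub hY).abs ((integrable_const _).add hg) (hosc x)
    _ = g x + ∫ y, g y ∂P := by
        rw [integral_add (integrable_const _) hg]; simp

lemma exp_sub_integral_le {Y g : α → ℝ} (hY : Integrable Y P) (hg : Integrable g P)
    (hosc : ∀ x y, |Y x - Y y| ≤ g x + g y)
    (hφ : Integrable (fun x => (2 * g x) ^ 2 * Real.exp (2 * g x)) P) (x : α) :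
    Real.exp (Y x - ∫ y, Y y ∂P) ≤ 1 + (Y x - ∫ y, Y y ∂P)
      + ((2 * g x) ^ 2 * Real.exp (2 * g x) + ∫ y, (2 * g y) ^ 2 * Real.exp (2 * g y) ∂P) / 2 := by
  have hg0 (y : α) : 0 ≤ g y := by linarith [hosc y y, abs_nonneg (Y y - Y y)]
  have hmean : (0 : ℝ) ≤ ∫ y, g y ∂P := integral_nonneg hg0
  set φ : ℝ → ℝ := fun t => t ^ 2 * Real.exp t with hφdef
  have hjensen : φ (2 * ∫ y, g y ∂P) ≤ ∫ y, φ (2 * g y) ∂P := by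
    rw [← integral_const_mul]
    exact convexOn_sq_mul_exp.map_integral_le (by fun_prop) isClosed_Ici
      (.of_forall fun y => mul_nonneg zero_le_two (hg0 y)) (hg.const_mul 2) hφ
  have hmid : φ (g x + ∫ y, g y ∂P) ≤ (φ (2 * g x) + φ (2 * ∫ y, g y ∂P)) / 2 := by
    have h := convexOn_sq_mul_exp.2 (mul_nonneg zero_le_two (hg0 x))
      (mul_nonneg zero_le_two hmean) one_half_pos.le one_half_pos.le (add_halves 1)
    simp only [smul_eq_mul] at h
    rw [show 1 / 2 * (2 * g x) + 1 / 2 * (2 * ∫ y, g y ∂P) = g x + ∫ y, g y ∂P by ring] at h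
    simp only [hφdef]
    linarith
  have hmono : φ |Y x - ∫ y, Y y ∂P| ≤ φ (g x + ∫ y, g y ∂P) :=
    monotoneOn_sq_mul_exp (Set.mem_Ici.2 (abs_nonneg _)) (add_nonneg (hg0 x) hmean)
      (abs_sub_integral_le hY hg hosc x)
  have htaylor := exp_le_one_add_add_sq_mul_exp_abs (Y x - ∫ y, Y y ∂P)
  simp only [hφdef, sq_abs] at hmono hmid hjensen
  linarith

lemma lintegral_exp_le_of_abs_sub_le {Y g : α → ℝ} (hY : Integrable Y P) (hg : Integrable g P)
    (hosc : ∀ x y, |Y x - Y y| ≤ g x + g y)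
    (hφ : Integrable (fun x => (2 * g x) ^ 2 * Real.exp (2 * g x)) P) :
    ∫⁻ x, ENNReal.ofReal (Real.exp (Y x)) ∂P
      ≤ ENNReal.ofReal (Real.exp (∫ x, Y x ∂P + ∫ x, (2 * g x) ^ 2 * Real.exp (2 * g x) ∂P)) := by
  set a := ∫ x, Y x ∂P with ha
  set r := ∫ x, (2 * g x) ^ 2 * Real.exp (2 * g x) ∂P with hr
  have hlin : Integrable (fun x => 1 + (Y x - a)) P :=
    (integrable_const _).add (hY.sub (integrable_const _))
  have hquad : Integrable (fun x => ((2 * g x) ^ 2 * Real.exp (2 * g x) + r) / 2) P :=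
    (hφ.add (integrable_const _)).div_const 2
  have hmean : ∫ x, (1 + (Y x - a) + ((2 * g x) ^ 2 * Real.exp (2 * g x) + r) / 2) ∂P = 1 + r := by
    have hcentre : Integrable (fun x => Y x - a) P := hY.sub (integrable_const _)
    rw [integral_add hlin hquad, integral_add (integrable_const _) hcentre,
      integral_sub hY (integrable_const _), integral_div,
      integral_add hφ (integrable_const _), ← ha, ← hr]
    simp
  have hcentred : ∫⁻ x, ENNReal.ofReal (Real.exp (Y x - a)) ∂P ≤ ENNReal.ofReal (Real.exp r) :=
    calc ∫⁻ x, ENNReal.ofReal (Real.exp (Y x - a)) ∂P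
        ≤ ∫⁻ x, ENNReal.ofReal
            (1 + (Y x - a) + ((2 * g x) ^ 2 * Real.exp (2 * g x) + r) / 2) ∂P :=
          lintegral_mono fun x =>
            ENNReal.ofReal_le_ofReal (exp_sub_integral_le hY hg hosc hφ x)
      _ = ENNReal.ofReal (1 + r) := by
          rw [← hmean]
          exact (ofReal_integral_eq_lintegral_ofReal (hlin.add hquad) (.of_forall fun x =>
            (Real.exp_pos _).le.trans (exp_sub_integral_le hY hg hosc hφ x))).symm
      _ ≤ ENNReal.ofReal (Real.exp r) :=
          ENNReal.ofReal_le_ofReal (by linarith [Real.add_one_le_exp r])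
  calc ∫⁻ x, ENNReal.ofReal (Real.exp (Y x)) ∂P
      = ∫⁻ x, ENNReal.ofReal (Real.exp a) * ENNReal.ofReal (Real.exp (Y x - a)) ∂P := by
        simp_rw [← ENNReal.ofReal_mul (Real.exp_pos _).le, ← Real.exp_add, add_sub_cancel]
    _ ≤ ENNReal.ofReal (Real.exp (a + r)) := by
        rw [lintegral_const_mul' _ _ ENNReal.ofReal_ne_top, Real.exp_add,
          ENNReal.ofReal_mul (Real.exp_pos _).le]
        gcongr

end ExponentialMoments

section BoundedDifferences

variable {α : Type*} [MeasurableSpace α]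

lemma measurePreserving_finCons {n : ℕ} (P : Fin (n + 1) → Measure α) [∀ i, SigmaFinite (P i)] :
    MeasurePreserving (fun q : α × (Fin n → α) => (Fin.cons q.1 q.2 : Fin (n + 1) → α))
      ((P 0).prod (Measure.pi fun i => P i.succ)) (Measure.pi P) := by
  simpa [MeasurableEquiv.piFinSuccAbove, Fin.insertNthEquiv] using
    (measurePreserving_piFinSuccAbove P 0).symm

theorem lintegral_exp_le_of_abs_update_sub_le {n : ℕ} {P : Fin n → Measure α}
    [∀ i, IsProbabilityMeasure (P i)] {g : Fin n → α → ℝ} (hg : ∀ i, Integrable (g i) (P i))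
    (hφ : ∀ i, Integrable (fun x => (2 * g i x) ^ 2 * Real.exp (2 * g i x)) (P i))
    {f : (Fin n → α) → ℝ} (hfm : Measurable f) (hf : Integrable f (Measure.pi P))
    (hdiff : ∀ z i x, |f (Function.update z i x) - f z| ≤ g i x + g i (z i)) :
    ∫⁻ z, ENNReal.ofReal (Real.exp (f z)) ∂(Measure.pi P)
      ≤ ENNReal.ofReal (Real.exp (∫ z, f z ∂(Measure.pi P)
          + ∑ i, ∫ x, (2 * g i x) ^ 2 * Real.exp (2 * g i x) ∂(P i))) := by
  induction n with
  | zero => simp [Measure.pi_of_empty P fun i => i.elim0]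
  | succ n ih =>
    set Q : Measure (Fin n → α) := Measure.pi fun i => P i.succ
    set F : α × (Fin n → α) → ℝ := fun q => f (Fin.cons q.1 q.2) with hF
    have hcons := measurePreserving_finCons P
    have hFm : Measurable F := hfm.comp hcons.measurable
    have hFi : Integrable F ((P 0).prod Q) := (hcons.integrable_comp hfm.aestronglyMeasurable).2 hf
    have hosc (w) (x y : α) : |F (x, w) - F (y, w)| ≤ g 0 x + g 0 y := by
      simpa [hF] using hdiff (Fin.cons y w) 0 x
    have hsection (w) : Integrable (fun x => F (x, w)) (P 0) :=
      integrable_of_abs_sub_le (hFm.comp measurable_prodMk_right).aestronglyMeasurable (hg 0)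
        (hosc w)
    set f₁ : (Fin n → α) → ℝ := fun w => ∫ x, F (x, w) ∂(P 0) with hf₁
    have hf₁m : Measurable f₁ := hFm.stronglyMeasurable.integral_prod_left'.measurable
    have hf₁diff (w) (i : Fin n) (x) :
        |f₁ (Function.update w i x) - f₁ w| ≤ g i.succ x + g i.succ (w i) := by
      rw [hf₁, ← integral_sub (hsection _) (hsection _)]
      refine abs_integral_le_integral_abs.trans ((integral_mono
        ((hsection _).sub (hsection _)).abs (integrable_const (g i.succ x + g i.succ (w i)))
        fun y => ?_).trans (by simp))
      simpa [hF, Fin.cons_update] using hdiff (Fin.cons y w) i.succ x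
    have hmean : ∫ w, f₁ w ∂Q = ∫ z, f z ∂(Measure.pi P) := by
      rw [← hcons.map_eq, integral_map hcons.aemeasurable hfm.aestronglyMeasurable,
        ← integral_prod_symm _ hFi]
    calc ∫⁻ z, ENNReal.ofReal (Real.exp (f z)) ∂(Measure.pi P)
        = ∫⁻ w, ∫⁻ x, ENNReal.ofReal (Real.exp (F (x, w))) ∂(P 0) ∂Q := by
          rw [← hcons.lintegral_comp hfm.exp.ennreal_ofReal]
          exact lintegral_prod_symm' _ hFm.exp.ennreal_ofReal
      _ ≤ ∫⁻ w, ENNReal.ofReal (Real.exp (∫ x, (2 * g 0 x) ^ 2 * Real.exp (2 * g 0 x) ∂(P 0)))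
            * ENNReal.ofReal (Real.exp (f₁ w)) ∂Q := by
          refine lintegral_mono fun w => ?_
          rw [← ENNReal.ofReal_mul (Real.exp_pos _).le, ← Real.exp_add, add_comm (∫ x, _ ∂(P 0))]
          exact lintegral_exp_le_of_abs_sub_le (hsection w) (hg 0) (hosc w) (hφ 0)
      _ ≤ _ := by
          rw [lintegral_const_mul' _ _ ENNReal.ofReal_ne_top, Fin.sum_univ_succ, ← hmean,
            add_left_comm, Real.exp_add, ENNReal.ofReal_mul (Real.exp_pos _).le]
          gcongr
          exact ih (fun i => hg i.succ) (fun i => hφ i.succ) hf₁m hFi.integral_prod_right hf₁diff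

end BoundedDifferences

section Wasserstein

open ProbabilityTheory (cdf)

/-- The quantile function of a measure on the line, meaningful on `(0, 1)`; outside it the
infimum may be the junk value `0`. -/
def quantile (μ : Measure ℝ) (u : ℝ) : ℝ :=
  sInf {t | u ≤ cdf μ t}

lemma quantile_le_iff (μ : Measure ℝ) {u : ℝ} (hu : u ∈ Set.Ioo 0 1) (t : ℝ) :
    quantile μ u ≤ t ↔ u ≤ cdf μ t := by
  have hne : {t | u ≤ cdf μ t}.Nonempty :=
    ((ProbabilityTheory.tendsto_cdf_atTop μ).eventually (eventually_ge_nhds hu.2)).exists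
  have hbdd : BddBelow {t | u ≤ cdf μ t} := by
    obtain ⟨b, hb⟩ :=
      ((ProbabilityTheory.tendsto_cdf_atBot μ).eventually (eventually_lt_nhds hu.1)).exists
    refine ⟨b, fun x (hx : u ≤ cdf μ x) => ?_⟩
    by_contra! hlt
    exact (hx.trans ((cdf μ).mono hlt.le)).not_gt hb
  refine ⟨fun h => ?_, fun h => csInf_le hbdd h⟩
  have hright : ∀ y, t < y → u ≤ cdf μ y := fun y hy =>
    have ⟨x, hx, hxy⟩ := exists_lt_of_csInf_lt hne (h.trans_lt hy)
    le_trans hx ((cdf μ).mono hxy.le)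
  exact ge_of_tendsto
    (((cdf μ).right_continuous t).mono_left (nhdsWithin_mono _ Set.Ioi_subset_Ici_self))
    (eventually_nhdsWithin_of_forall hright)

lemma monotoneOn_quantile (μ : Measure ℝ) : MonotoneOn (quantile μ) (Set.Ioo 0 1) := by
  intro u hu v hv huv
  rw [quantile_le_iff μ hu]
  exact huv.trans ((quantile_le_iff μ hv _).1 le_rfl)

lemma aemeasurable_quantile (μ : Measure ℝ) :
    AEMeasurable (quantile μ) (volume.restrict (Set.Ioo 0 1)) :=
  aemeasurable_restrict_of_monotoneOn measurableSet_Ioo (monotoneOn_quantile μ)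

lemma map_quantile (μ : Measure ℝ) [IsProbabilityMeasure μ] :
    (volume.restrict (Set.Ioo 0 1)).map (quantile μ) = μ := by
  have : IsProbabilityMeasure (volume.restrict (Set.Ioo (0 : ℝ) 1)) := ⟨by simp⟩
  have := Measure.isProbabilityMeasure_map (aemeasurable_quantile μ)
  refine Measure.ext_of_Iic _ _ fun t => ?_
  have hpre : quantile μ ⁻¹' Set.Iic t ∩ Set.Ioo 0 1 = Set.Iic (cdf μ t) ∩ Set.Ioo 0 1 := by
    ext u
    simp only [Set.mem_inter_iff, Set.mem_preimage, Set.mem_Iic, and_congr_left_iff]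
    exact fun hu => quantile_le_iff μ hu t
  rw [Measure.map_apply_of_aemeasurable (aemeasurable_quantile μ) measurableSet_Iic,
    Measure.restrict_apply' measurableSet_Ioo, hpre, ← ProbabilityTheory.ofReal_cdf]
  apply le_antisymm
  · calc volume (Set.Iic (cdf μ t) ∩ Set.Ioo 0 1)
        ≤ volume (Set.Ioc 0 (cdf μ t)) := measure_mono fun u hu => ⟨hu.2.1, hu.1⟩
      _ = ENNReal.ofReal (cdf μ t) := by simp
  · calc ENNReal.ofReal (cdf μ t) = volume (Set.Ioo 0 (cdf μ t)) := by simp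
      _ ≤ volume (Set.Iic (cdf μ t) ∩ Set.Ioo 0 1) := measure_mono fun u hu =>
        ⟨hu.2.le, hu.1, hu.2.trans_le (ProbabilityTheory.cdf_le_one μ t)⟩

/-- The distribution function `t ↦ 1 {a ≤ t}` of the point mass at `a`, as a function of both
variables. -/
def step (a t : ℝ) : ℝ := if a ≤ t then 1 else 0

lemma measurable_step : Measurable fun q : ℝ × ℝ => step q.1 q.2 :=
  Measurable.ite (measurableSet_le measurable_fst measurable_snd) measurable_const
    measurable_const

lemma lintegral_enorm_step_sub_step_left (s t : ℝ) :
    ∫⁻ a, ‖step a s - step a t‖ₑ = ‖s - t‖ₑ := by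
  have hind (a : ℝ) : ‖step a s - step a t‖ₑ = (Set.Ioc (min s t) (max s t)).indicator 1 a := by
    simp only [Set.indicator_apply, Set.mem_Ioc, min_lt_iff, le_max_iff]
    by_cases hs : a ≤ s <;> by_cases ht : a ≤ t <;> simp [step, hs, ht, not_le.1]
  simp_rw [hind]
  rw [lintegral_indicator_one measurableSet_Ioc, Real.volume_Ioc, max_sub_min_eq_abs',
    Real.enorm_eq_ofReal_abs]

lemma lintegral_enorm_step_sub_step_right (a b : ℝ) :
    ∫⁻ t, ‖step a t - step b t‖ₑ = ‖a - b‖ₑ := by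
  have hneg (a t : ℝ) : step a t = step (-t) (-a) := by simp [step]
  simp_rw [hneg a, hneg b]
  rw [lintegral_neg_eq_self fun t => ‖step t (-a) - step t (-b)‖ₑ,
    lintegral_enorm_step_sub_step_left, neg_sub_neg, enorm_sub_rev]

lemma lintegral_enorm_step_sub_step_sq_mul_le (a b : ℝ) :
    ∫⁻ t, ‖step a t - step b t‖ₑ ^ 2 * ENNReal.ofReal (1 + t ^ 2)
      ≤ ‖a - b‖ₑ * ENNReal.ofReal (1 + a ^ 2 + b ^ 2) := by
  rw [← lintegral_enorm_step_sub_step_right, ← lintegral_mul_const' _ _ ENNReal.ofReal_ne_top]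
  refine lintegral_mono fun t => ?_
  have hsq (hat : a ≤ t ∧ t < b ∨ b ≤ t ∧ t < a) : t ^ 2 ≤ a ^ 2 + b ^ 2 := by
    rcases le_total 0 t with ht | ht <;> rcases hat with h | h <;> nlinarith
  by_cases ha : a ≤ t <;> by_cases hb : b ≤ t <;> simp only [step, ha, hb, if_true, if_false]
  · simp
  · simpa using ENNReal.ofReal_le_ofReal (by linarith [hsq (.inl ⟨ha, not_le.1 hb⟩)])
  · simpa using ENNReal.ofReal_le_ofReal (by linarith [hsq (.inr ⟨hb, not_le.1 ha⟩)])
  · simp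

theorem wasserstein1_le_lintegral_cdf (μ ν : Measure ℝ) [IsProbabilityMeasure μ]
    [IsProbabilityMeasure ν] : wasserstein1 μ ν ≤ ∫⁻ t, ‖cdf μ t - cdf ν t‖ₑ := by
  set U : Measure ℝ := volume.restrict (Set.Ioo 0 1)
  have hμ : AEMeasurable (quantile μ) U := aemeasurable_quantile μ
  have hν : AEMeasurable (quantile ν) U := aemeasurable_quantile ν
  have hfst : (U.map fun u => (quantile μ u, quantile ν u)).fst = μ := by
    rw [Measure.fst_map_prodMk₀ hν, map_quantile]
  have hsnd : (U.map fun u => (quantile μ u, quantile ν u)).snd = ν := by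
    rw [Measure.snd_map_prodMk₀ hμ, map_quantile]
  have hmeas (κ : Measure ℝ) : Measurable fun q : ℝ × ℝ => step q.1 (cdf κ q.2) :=
    measurable_step.comp (measurable_fst.prodMk
      ((ProbabilityTheory.monotone_cdf κ).measurable.comp measurable_snd))
  calc wasserstein1 μ ν
      ≤ ∫⁻ q, ENNReal.ofReal |q.1 - q.2| ∂(U.map fun u => (quantile μ u, quantile ν u)) :=
        iInf₂_le (U.map fun u => (quantile μ u, quantile ν u)) ⟨hfst, hsnd⟩
    _ = ∫⁻ u, ‖quantile μ u - quantile ν u‖ₑ ∂U := by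
        rw [lintegral_map' (by fun_prop) (hμ.prodMk hν)]
        simp only [Real.enorm_eq_ofReal_abs]
    _ = ∫⁻ u, (∫⁻ t, ‖step u (cdf μ t) - step u (cdf ν t)‖ₑ) ∂U := by
        refine setLIntegral_congr_fun measurableSet_Ioo fun u hu => ?_
        rw [← lintegral_enorm_step_sub_step_right]
        simp only [step, quantile_le_iff μ hu, quantile_le_iff ν hu]
    _ = ∫⁻ t, ∫⁻ u, ‖step u (cdf μ t) - step u (cdf ν t)‖ₑ ∂U :=
        lintegral_lintegral_swap ((hmeas μ).sub (hmeas ν)).enorm.aemeasurable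
    _ ≤ ∫⁻ t, ‖cdf μ t - cdf ν t‖ₑ := by
        refine lintegral_mono fun t => ?_
        rw [← lintegral_enorm_step_sub_step_left]
        exact setLIntegral_le_lintegral _ _

end Wasserstein

section Deviation

open Function (uncurry)

variable {α E : Type*} [MeasurableSpace α]

/-- The deviation at `e` of the mean of `h (·, e)` over the sample `z` from its expectation
under `P`. -/
def deviation (P : Measure α) (h : α → E → ℝ) {m : ℕ} (z : Fin m → α) (e : E) : ℝ :=
  (m : ℝ)⁻¹ * ∑ j, h (z j) e - ∫ x, h x e ∂P

variable {P : Measure α} {h : α → E → ℝ} {m : ℕ}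

lemma deviation_sub {h' : α → E → ℝ} (hh : ∀ e, Integrable (fun x => h x e) P)
    (hh' : ∀ e, Integrable (fun x => h' x e) P) (z : Fin m → α) :
    deviation P (h - h') z = deviation P h z - deviation P h' z := by
  ext e
  simp only [deviation, Pi.sub_apply, Finset.sum_sub_distrib, integral_sub (hh e) (hh' e)]
  ring

lemma deviation_update_sub_deviation (z : Fin m → α) (j : Fin m) (x : α) :
    deviation P h (Function.update z j x) - deviation P h z
      = (m : ℝ)⁻¹ • (h x - h (z j)) := by
  ext e
  have hsum : ∑ i, h (Function.update z j x i) e - ∑ i, h (z i) e = h x e - h (z j) e := by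
    rw [← Finset.sum_sub_distrib]
    exact (Finset.sum_eq_single_of_mem j (Finset.mem_univ _) fun i _ hi => by simp [hi]).trans
      (by simp)
  simp only [deviation, Pi.sub_apply, Pi.smul_apply, smul_eq_mul, ← hsum]
  ring

variable [MeasurableSpace E] {ν : Measure E}

lemma measurable_deviation [SFinite P] (hh : Measurable (uncurry h)) :
    Measurable fun q : (Fin m → α) × E => deviation P h q.1 q.2 := by
  have hmean : Measurable fun e => ∫ x, h x e ∂P :=
    hh.stronglyMeasurable.integral_prod_left.measurable
  exact ((Finset.measurable_sum _ fun j _ => hh.comp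
    (((measurable_pi_apply j).comp measurable_fst).prodMk measurable_snd)).const_mul _).sub
      (hmean.comp measurable_snd)

lemma measurable_eLpNorm_deviation [SFinite P] [SFinite ν] (hh : Measurable (uncurry h)) :
    Measurable fun z : Fin m → α => eLpNorm (deviation P h z) 1 ν := by
  simp_rw [eLpNorm_one_eq_lintegral_enorm]
  exact (measurable_deviation hh).enorm.lintegral_prod_right'

lemma eLpNorm_deviation_le [SFinite P] [SFinite ν] (hh : Measurable (uncurry h)) (z : Fin m → α) :
    eLpNorm (deviation P h z) 1 ν
      ≤ (m : ℝ≥0∞)⁻¹ * ∑ j, eLpNorm (h (z j)) 1 ν + ∫⁻ x, eLpNorm (h x) 1 ν ∂P := by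
  have hsec (x : α) : Measurable fun e => ‖h x e‖ₑ := (hh.comp measurable_prodMk_left).enorm
  have hmean : Measurable fun e => ∫⁻ x, ‖h x e‖ₑ ∂P := hh.enorm.lintegral_prod_left'
  simp_rw [eLpNorm_one_eq_lintegral_enorm]
  calc ∫⁻ e, ‖deviation P h z e‖ₑ ∂ν
      ≤ ∫⁻ e, ((m : ℝ≥0∞)⁻¹ * ∑ j, ‖h (z j) e‖ₑ + ∫⁻ x, ‖h x e‖ₑ ∂P) ∂ν := by
        refine lintegral_mono fun e => enorm_sub_le.trans ?_
        rw [enorm_mul]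
        gcongr
        · rcases eq_or_ne (m : ℝ) 0 with hm | hm
          · simp [hm]
          · simp [enorm_inv hm]
        · exact enorm_sum_le _ _
        · exact enorm_integral_le_lintegral_enorm _
    _ = _ := by
        rw [lintegral_add_right _ hmean,
          lintegral_const_mul _ (Finset.measurable_sum _ fun j _ => hsec (z j)),
          lintegral_finsetSum _ fun j _ => hsec (z j),
          lintegral_lintegral_swap (hh.comp measurable_swap).enorm.aemeasurable]

lemma abs_toReal_eLpNorm_sub_le {u v : E → ℝ} (hu : MemLp u 1 ν) (hv : MemLp v 1 ν) :
    |(eLpNorm u 1 ν).toReal - (eLpNorm v 1 ν).toReal| ≤ (eLpNorm (u - v) 1 ν).toReal := by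
  rw [← Lp.norm_toLp u hu, ← Lp.norm_toLp v hv, ← Lp.norm_toLp _ (hu.sub hv), MemLp.toLp_sub]
  exact abs_norm_sub_norm_le _ _

end Deviation

section MeanDeviation

open Function (uncurry)

variable {α E : Type*} [MeasurableSpace α] [MeasurableSpace E] {P : Measure α}
  [IsProbabilityMeasure P] {ν : Measure E} {m : ℕ}

lemma mul_lintegral_enorm_average_sub_integral_sq_le {X : α → ℝ} (hX : MemLp X 2 P) (hm : 0 < m) :
    m * ∫⁻ z : Fin m → α, ‖(m : ℝ)⁻¹ * ∑ j, X (z j) - ∫ x, X x ∂P‖ₑ ^ 2 ∂(Measure.pi fun _ => P)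
      ≤ ∫⁻ x, ‖X x‖ₑ ^ 2 ∂P := by
  set S : (Fin m → α) → ℝ := ∑ j, fun z => X (z j) with hS
  have hcoord (j : Fin m) : MemLp (fun z : Fin m → α => X (z j)) 2 (Measure.pi fun _ => P) :=
    hX.comp_measurePreserving (measurePreserving_eval _ j)
  have hmean : ∫ z, (m : ℝ)⁻¹ * S z ∂(Measure.pi fun _ => P) = ∫ x, X x ∂P := by
    simp only [hS, Finset.sum_apply]
    rw [integral_const_mul, integral_finsetSum _ fun j _ => (hcoord j).integrable one_le_two]
    simp_rw [integral_comp_eval (μ := fun _ : Fin m => P) hX.aestronglyMeasurable]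
    simp [hm.ne']
  have hvar : ProbabilityTheory.evariance S (Measure.pi fun _ => P)
      = m * ENNReal.ofReal (ProbabilityTheory.variance X P) := by
    rw [← (memLp_finsetSum' _ fun j _ => hcoord j).ofReal_variance_eq,
      ProbabilityTheory.variance_sum_pi fun _ => hX]
    simp [ENNReal.ofReal_mul]
  have hsq : ENNReal.ofReal (ProbabilityTheory.variance X P) ≤ ∫⁻ x, ‖X x‖ₑ ^ 2 ∂P := by
    refine (ENNReal.ofReal_le_ofReal
      (ProbabilityTheory.variance_le_expectation_sq hX.aestronglyMeasurable)).trans_eq ?_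
    simp_rw [Pi.pow_apply, ← enorm_pow, Real.enorm_of_nonneg (sq_nonneg _)]
    exact ofReal_integral_eq_lintegral_ofReal hX.integrable_sq (.of_forall fun x => sq_nonneg _)
  calc m * ∫⁻ z : Fin m → α, ‖(m : ℝ)⁻¹ * ∑ j, X (z j) - ∫ x, X x ∂P‖ₑ ^ 2
        ∂(Measure.pi fun _ => P)
      = m * ProbabilityTheory.evariance (fun z => (m : ℝ)⁻¹ * S z) (Measure.pi fun _ => P) := by
        rw [ProbabilityTheory.evariance, hmean]
        simp [hS]
    _ = ENNReal.ofReal (ProbabilityTheory.variance X P) := by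
        rw [ProbabilityTheory.evariance_mul, hvar, ← mul_assoc, ← mul_assoc,
          ← ENNReal.ofReal_natCast, ← ENNReal.ofReal_mul (by positivity),
          ← ENNReal.ofReal_mul (by positivity),
          show (m : ℝ) * (m : ℝ)⁻¹ ^ 2 * m = 1 by field_simp, ENNReal.ofReal_one, one_mul]
    _ ≤ ∫⁻ x, ‖X x‖ₑ ^ 2 ∂P := hsq

lemma mul_sqrt_mul_enorm_le {a w : ℝ} (ha : 0 < a) (hw : 0 < w) (y : ℝ) :
    ENNReal.ofReal √m * ‖y‖ₑ
      ≤ ENNReal.ofReal a * (m * (‖y‖ₑ ^ 2 * ENNReal.ofReal w))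
        + ENNReal.ofReal a⁻¹ * ENNReal.ofReal w⁻¹ := by
  rw [← enorm_pow, Real.enorm_eq_ofReal_abs, Real.enorm_eq_ofReal_abs, ← ENNReal.ofReal_natCast,
    ← ENNReal.ofReal_mul (by positivity), ← ENNReal.ofReal_mul (by positivity),
    ← ENNReal.ofReal_mul (by positivity), ← ENNReal.ofReal_mul (by positivity),
    ← ENNReal.ofReal_mul (by positivity), ← ENNReal.ofReal_add (by positivity) (by positivity)]
  refine ENNReal.ofReal_le_ofReal ?_
  have hamgm := two_mul_le_add_sq (√m * |y| * (a * w)) 1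
  rw [abs_of_nonneg (sq_nonneg y)]
  have hexpand : (√m * |y| * (a * w)) ^ 2 = m * y ^ 2 * (a * w) ^ 2 := by
    rw [mul_pow, mul_pow, Real.sq_sqrt m.cast_nonneg, sq_abs]
  have hmul : √m * |y| * (a * w) ≤ (a * (m * (y ^ 2 * w)) + a⁻¹ * w⁻¹) * (a * w) := by
    have : 0 ≤ √m * |y| * (a * w) := by positivity
    calc √m * |y| * (a * w) ≤ m * y ^ 2 * (a * w) ^ 2 + 1 := by linarith
      _ = (a * (m * (y ^ 2 * w)) + a⁻¹ * w⁻¹) * (a * w) := by field_simp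
  exact le_of_mul_le_mul_right hmul (by positivity)

lemma lintegral_sqrt_mul_enorm_average_sub_integral_le {X : α → ℝ} (hX : MemLp X 2 P) (hm : 0 < m)
    {a w : ℝ} (ha : 0 < a) (hw : 0 < w) :
    ∫⁻ z : Fin m → α, ENNReal.ofReal √m * ‖(m : ℝ)⁻¹ * ∑ j, X (z j) - ∫ x, X x ∂P‖ₑ
        ∂(Measure.pi fun _ => P)
      ≤ ENNReal.ofReal a * ∫⁻ x, ‖X x‖ₑ ^ 2 * ENNReal.ofReal w ∂P
        + ENNReal.ofReal a⁻¹ * ENNReal.ofReal w⁻¹ := by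
  refine (lintegral_mono fun z => mul_sqrt_mul_enorm_le ha hw _).trans ?_
  rw [lintegral_add_right _ measurable_const, lintegral_const_mul' _ _ ENNReal.ofReal_ne_top,
    lintegral_const_mul' _ _ (ENNReal.natCast_ne_top m),
    lintegral_mul_const' _ _ ENNReal.ofReal_ne_top,
    lintegral_mul_const' _ _ ENNReal.ofReal_ne_top, ← mul_assoc (m : ℝ≥0∞), lintegral_const,
    measure_univ, mul_one, lintegral_mul_const' _ _ ENNReal.ofReal_ne_top]
  gcongr
  exact mul_lintegral_enorm_average_sub_integral_sq_le hX hm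

lemma lintegral_eLpNorm_deviation_le [SFinite ν] {h : α → E → ℝ} (hm : 0 < m)
    (hh : Measurable (uncurry h)) (hsq : ∀ e, MemLp (fun x => h x e) 2 P) {w : E → ℝ}
    (hwm : Measurable w) (hw : ∀ e, 0 < w e) {a : ℝ} (ha : 0 < a) :
    ENNReal.ofReal √m * ∫⁻ z : Fin m → α, eLpNorm (deviation P h z) 1 ν ∂(Measure.pi fun _ => P)
      ≤ ENNReal.ofReal a * ∫⁻ x, ∫⁻ e, ‖h x e‖ₑ ^ 2 * ENNReal.ofReal (w e) ∂ν ∂P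
        + ENNReal.ofReal a⁻¹ * ∫⁻ e, ENNReal.ofReal (w e)⁻¹ ∂ν := by
  have hdev : Measurable fun q : (Fin m → α) × E => ENNReal.ofReal √m * ‖deviation P h q.1 q.2‖ₑ :=
    (measurable_deviation hh).enorm.const_mul _
  have hsqm : Measurable fun q : E × α => ‖h q.2 q.1‖ₑ ^ 2 * ENNReal.ofReal (w q.1) :=
    ((hh.comp measurable_swap).enorm.pow_const 2).mul (hwm.comp measurable_fst).ennreal_ofReal
  have hinv : Measurable fun e => ENNReal.ofReal a⁻¹ * ENNReal.ofReal (w e)⁻¹ :=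
    hwm.inv.ennreal_ofReal.const_mul _
  calc ENNReal.ofReal √m * ∫⁻ z : Fin m → α, eLpNorm (deviation P h z) 1 ν ∂(Measure.pi fun _ => P)
      = ∫⁻ z : Fin m → α, ∫⁻ e, ENNReal.ofReal √m * ‖deviation P h z e‖ₑ ∂ν
          ∂(Measure.pi fun _ => P) := by
        rw [← lintegral_const_mul' _ _ ENNReal.ofReal_ne_top]
        refine lintegral_congr fun z => ?_
        rw [eLpNorm_one_eq_lintegral_enorm, lintegral_const_mul' _ _ ENNReal.ofReal_ne_top]
    _ = ∫⁻ e, ∫⁻ z : Fin m → α, ENNReal.ofReal √m * ‖deviation P h z e‖ₑ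
          ∂(Measure.pi fun _ => P) ∂ν := lintegral_lintegral_swap hdev.aemeasurable
    _ ≤ ∫⁻ e, (ENNReal.ofReal a * ∫⁻ x, ‖h x e‖ₑ ^ 2 * ENNReal.ofReal (w e) ∂P
          + ENNReal.ofReal a⁻¹ * ENNReal.ofReal (w e)⁻¹) ∂ν :=
        lintegral_mono fun e =>
          lintegral_sqrt_mul_enorm_average_sub_integral_le (hsq e) hm ha (hw e)
    _ = ENNReal.ofReal a * ∫⁻ e, ∫⁻ x, ‖h x e‖ₑ ^ 2 * ENNReal.ofReal (w e) ∂P ∂ν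
          + ENNReal.ofReal a⁻¹ * ∫⁻ e, ENNReal.ofReal (w e)⁻¹ ∂ν := by
        rw [lintegral_add_right _ hinv, lintegral_const_mul' _ _ ENNReal.ofReal_ne_top,
          lintegral_const_mul' _ _ ENNReal.ofReal_ne_top]
    _ = ENNReal.ofReal a * ∫⁻ x, ∫⁻ e, ‖h x e‖ₑ ^ 2 * ENNReal.ofReal (w e) ∂ν ∂P
          + ENNReal.ofReal a⁻¹ * ∫⁻ e, ENNReal.ofReal (w e)⁻¹ ∂ν := by
        rw [lintegral_lintegral_swap hsqm.aemeasurable]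

end MeanDeviation

section TiltedSquare

lemma sq_mul_exp_two_mul_le {c κ t : ℝ} (hcκ : 2 * c ≤ κ) (ht : 0 ≤ t) :
    (2 * (c * t)) ^ 2 * Real.exp (2 * (c * t)) ≤ 4 * c ^ 2 * (t ^ 2 * Real.exp (κ * t)) := by
  calc (2 * (c * t)) ^ 2 * Real.exp (2 * (c * t))
      ≤ (2 * (c * t)) ^ 2 * Real.exp (κ * t) := by
        refine mul_le_mul_of_nonneg_left (Real.exp_le_exp.2 ?_) (sq_nonneg _)
        nlinarith
    _ = 4 * c ^ 2 * (t ^ 2 * Real.exp (κ * t)) := by ring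

variable {α : Type*} [MeasurableSpace α] {P : Measure α} {g : α → ℝ} {κ c : ℝ}

lemma integrable_sq_mul_exp_two_mul (hg0 : ∀ x, 0 ≤ g x) (hg : AEStronglyMeasurable g P)
    (hφ : Integrable (fun x => g x ^ 2 * Real.exp (κ * g x)) P) (hcκ : 2 * c ≤ κ) :
    Integrable (fun x => (2 * (c * g x)) ^ 2 * Real.exp (2 * (c * g x))) P := by
  refine (hφ.const_mul (4 * c ^ 2)).mono' (by fun_prop) (.of_forall fun x => ?_)
  rw [Real.norm_of_nonneg (by positivity)]
  exact sq_mul_exp_two_mul_le hcκ (hg0 x)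

lemma integral_sq_mul_exp_two_mul_le (hg0 : ∀ x, 0 ≤ g x)
    (hφ : Integrable (fun x => g x ^ 2 * Real.exp (κ * g x)) P) (hcκ : 2 * c ≤ κ) :
    ∫ x, (2 * (c * g x)) ^ 2 * Real.exp (2 * (c * g x)) ∂P
      ≤ 4 * c ^ 2 * ∫ x, g x ^ 2 * Real.exp (κ * g x) ∂P := by
  rw [← integral_const_mul]
  exact integral_mono_of_nonneg (.of_forall fun x => by positivity) (hφ.const_mul _)
    (.of_forall fun x => sq_mul_exp_two_mul_le hcκ (hg0 x))

end TiltedSquare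

section ExponentialDeviation

open Function (uncurry)

variable {α E : Type*} [MeasurableSpace α] [MeasurableSpace E] {P : Measure α}
  {ν : Measure E} [SFinite ν] {m : ℕ} {h : α → E → ℝ} {g : α → ℝ}

lemma eLpNorm_deviation_le_of_le [SFinite P] (hh : Measurable (uncurry h)) (hg0 : ∀ x, 0 ≤ g x)
    (hg : Integrable g P) (hle : ∀ x, eLpNorm (h x) 1 ν ≤ ENNReal.ofReal (g x)) (z : Fin m → α) :
    eLpNorm (deviation P h z) 1 ν
      ≤ ENNReal.ofReal ((m : ℝ)⁻¹ * ∑ j, g (z j) + ∫ x, g x ∂P) := by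
  rcases Nat.eq_zero_or_pos m with rfl | hm
  · refine (eLpNorm_deviation_le hh z).trans ?_
    simp only [Finset.univ_eq_empty, Finset.sum_empty, mul_zero, zero_add]
    rw [ofReal_integral_eq_lintegral_ofReal hg (.of_forall hg0)]
    exact lintegral_mono hle
  have hsum : 0 ≤ ∑ j, g (z j) := Finset.sum_nonneg fun j _ => hg0 _
  rw [ENNReal.ofReal_add (by positivity) (integral_nonneg hg0),
    ENNReal.ofReal_mul (by positivity), ENNReal.ofReal_inv_of_pos (by positivity),
    ENNReal.ofReal_natCast, ENNReal.ofReal_sum_of_nonneg fun j _ => hg0 _,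
    ofReal_integral_eq_lintegral_ofReal hg (.of_forall hg0)]
  exact (eLpNorm_deviation_le hh z).trans (by gcongr with j _ x <;> exact hle _)

lemma memLp_deviation [SFinite P] (hh : Measurable (uncurry h)) (hg0 : ∀ x, 0 ≤ g x)
    (hg : Integrable g P) (hle : ∀ x, eLpNorm (h x) 1 ν ≤ ENNReal.ofReal (g x)) (z : Fin m → α) :
    MemLp (deviation P h z) 1 ν :=
  ⟨((measurable_deviation hh).comp measurable_prodMk_left).aestronglyMeasurable,
    (eLpNorm_deviation_le_of_le hh hg0 hg hle z).trans_lt ENNReal.ofReal_lt_top⟩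

lemma abs_toReal_eLpNorm_deviation_update_sub_le [SFinite P] (hh : Measurable (uncurry h))
    (hg0 : ∀ x, 0 ≤ g x) (hg : Integrable g P)
    (hle : ∀ x, eLpNorm (h x) 1 ν ≤ ENNReal.ofReal (g x)) (z : Fin m → α) (j : Fin m) (x : α) :
    |(eLpNorm (deviation P h (Function.update z j x)) 1 ν).toReal
        - (eLpNorm (deviation P h z) 1 ν).toReal| ≤ (m : ℝ)⁻¹ * (g x + g (z j)) := by
  refine (abs_toReal_eLpNorm_sub_le (memLp_deviation hh hg0 hg hle _)
    (memLp_deviation hh hg0 hg hle _)).trans ?_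
  have hsec (y : α) : AEStronglyMeasurable (h y) ν :=
    (hh.comp measurable_prodMk_left).aestronglyMeasurable
  rw [deviation_update_sub_deviation, eLpNorm_const_smul, ENNReal.toReal_mul, toReal_enorm,
    Real.norm_of_nonneg (by positivity)]
  gcongr
  refine ENNReal.toReal_le_of_le_ofReal (add_nonneg (hg0 _) (hg0 _)) ?_
  rw [ENNReal.ofReal_add (hg0 _) (hg0 _)]
  exact (eLpNorm_sub_le (hsec _) (hsec _) le_rfl).trans (add_le_add (hle _) (hle _))

variable [IsProbabilityMeasure P]

lemma integrable_toReal_eLpNorm_deviation (hh : Measurable (uncurry h)) (hg0 : ∀ x, 0 ≤ g x)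
    (hg : Integrable g P) (hle : ∀ x, eLpNorm (h x) 1 ν ≤ ENNReal.ofReal (g x)) :
    Integrable (fun z : Fin m → α => (eLpNorm (deviation P h z) 1 ν).toReal)
      (Measure.pi fun _ => P) := by
  have hbound : Integrable (fun z : Fin m → α => (m : ℝ)⁻¹ * ∑ j, g (z j) + ∫ x, g x ∂P)
      (Measure.pi fun _ => P) :=
    ((integrable_finsetSum _ fun j _ => integrable_comp_eval hg).const_mul _).add
      (integrable_const _)
  refine hbound.mono' (measurable_eLpNorm_deviation hh).ennreal_toReal.aestronglyMeasurable
    (.of_forall fun z => ?_)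
  rw [Real.norm_of_nonneg ENNReal.toReal_nonneg]
  refine ENNReal.toReal_le_of_le_ofReal ?_ (eLpNorm_deviation_le_of_le hh hg0 hg hle z)
  exact add_nonneg (mul_nonneg (by positivity) (Finset.sum_nonneg fun j _ => hg0 _))
    (integral_nonneg hg0)

theorem lintegral_exp_eLpNorm_deviation_le (hh : Measurable (uncurry h)) (hg0 : ∀ x, 0 ≤ g x)
    (hg : Integrable g P) (hle : ∀ x, eLpNorm (h x) 1 ν ≤ ENNReal.ofReal (g x)) {κ s : ℝ}
    (hφ : Integrable (fun x => g x ^ 2 * Real.exp (κ * g x)) P) (hm : 0 < m) (hs : 0 ≤ s)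
    (hsκ : 2 * s ≤ κ * √m) :
    ∫⁻ z : Fin m → α, ENNReal.ofReal
        (Real.exp (s * (√m * (eLpNorm (deviation P h z) 1 ν).toReal))) ∂(Measure.pi fun _ => P)
      ≤ ENNReal.ofReal (Real.exp
          (s * (√m * ∫ z : Fin m → α, (eLpNorm (deviation P h z) 1 ν).toReal
              ∂(Measure.pi fun _ => P))
            + 4 * s ^ 2 * ∫ x, g x ^ 2 * Real.exp (κ * g x) ∂P)) := by
  have hm' : (0 : ℝ) < m := by exact_mod_cast hm
  set c : ℝ := s / √m with hc
  have : 0 ≤ c := by positivity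
  have hc2 : m * c ^ 2 = s ^ 2 := by rw [hc, div_pow, Real.sq_sqrt hm'.le]; field_simp
  have hcm : s * √m * (m : ℝ)⁻¹ = c := by
    rw [hc]
    field_simp
    rw [Real.sq_sqrt hm'.le]
  have hcκ : 2 * c ≤ κ := by rwa [hc, mul_div_assoc', div_le_iff₀ (by positivity)]
  refine (lintegral_exp_le_of_abs_update_sub_le (P := fun _ : Fin m => P)
    (g := fun _ x => c * g x) (fun _ => hg.const_mul c)
    (fun _ => integrable_sq_mul_exp_two_mul hg0 hg.1 hφ hcκ)
    (((measurable_eLpNorm_deviation hh).ennreal_toReal.const_mul _).const_mul _)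
    (((integrable_toReal_eLpNorm_deviation hh hg0 hg hle).const_mul _).const_mul _)
    fun z j x => ?_).trans ?_
  · rw [← mul_sub, ← mul_sub, abs_mul, abs_mul, abs_of_nonneg hs, abs_of_nonneg (by positivity),
      ← mul_add, ← hcm, ← mul_assoc, mul_assoc _ (m : ℝ)⁻¹]
    gcongr
    exact abs_toReal_eLpNorm_deviation_update_sub_le hh hg0 hg hle z j x
  · refine ENNReal.ofReal_le_ofReal (Real.exp_le_exp.2 ?_)
    simp only [integral_const_mul, Finset.sum_const, Finset.card_univ, Fintype.card_fin,
      nsmul_eq_mul]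
    refine add_le_add le_rfl ?_
    calc m * ∫ x, (2 * (c * g x)) ^ 2 * Real.exp (2 * (c * g x)) ∂P
        ≤ m * (4 * c ^ 2 * ∫ x, g x ^ 2 * Real.exp (κ * g x) ∂P) := by
          gcongr
          exact integral_sq_mul_exp_two_mul_le hg0 hφ hcκ
      _ = 4 * s ^ 2 * ∫ x, g x ^ 2 * Real.exp (κ * g x) ∂P := by rw [← hc2]; ring

end ExponentialDeviation

section Slices

lemma sphereUniform_univ_le_one (p : ℕ) : sphereUniform p Set.univ ≤ 1 := by
  simp only [sphereUniform, Measure.smul_apply, smul_eq_mul]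
  exact ENNReal.inv_mul_le_one _

instance (p : ℕ) : IsFiniteMeasure (sphereUniform p) :=
  ⟨(sphereUniform_univ_le_one p).trans_lt ENNReal.one_lt_top⟩

lemma lintegral_sphereUniform_le {p : ℕ}
    {F : Metric.sphere (0 : EuclideanSpace ℝ (Fin p)) 1 → ℝ≥0∞} {c : ℝ≥0∞}
    (hF : ∀ ω, F ω ≤ c) : ∫⁻ ω, F ω ∂(sphereUniform p) ≤ c :=
  calc ∫⁻ ω, F ω ∂(sphereUniform p) ≤ ∫⁻ _, c ∂(sphereUniform p) := lintegral_mono hF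
    _ = c * sphereUniform p Set.univ := lintegral_const _
    _ ≤ c := mul_le_of_le_one_right' (sphereUniform_univ_le_one p)

/-- The space of half-spaces `{v | ⟨ω, v⟩ ≤ t}`, encoded as pairs `(ω, t)`. -/
abbrev HalfSpace (p : ℕ) : Type :=
  Metric.sphere (0 : EuclideanSpace ℝ (Fin p)) 1 × ℝ

/-- The product of the uniform measure on directions and Lebesgue measure on thresholds, for which
the sliced distance is an `L¹` distance of half-space probabilities. -/
def sliceMeasure (p : ℕ) : Measure (HalfSpace p) :=
  (sphereUniform p).prod volume

instance (p : ℕ) : SFinite (sliceMeasure p) :=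
  inferInstanceAs (SFinite ((sphereUniform p).prod volume))

variable {α : Type*} {p : ℕ} {T T' : α → EuclideanSpace ℝ (Fin p)}

/-- The indicator that `T x` lies in the half-space `⟨ω, ·⟩ ≤ t`, as a function of `x` and
`e = (ω, t)`. -/
def slice (T : α → EuclideanSpace ℝ (Fin p)) (x : α) (e : HalfSpace p) : ℝ :=
  step (inner ℝ (e.1 : EuclideanSpace ℝ (Fin p)) (T x)) e.2

lemma enorm_inner_sphere_le (ω : Metric.sphere (0 : EuclideanSpace ℝ (Fin p)) 1)
    (v : EuclideanSpace ℝ (Fin p)) : ‖inner ℝ (ω : EuclideanSpace ℝ (Fin p)) v‖ₑ ≤ ‖v‖ₑ := by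
  rw [enorm_le_iff_norm_le]
  simpa [norm_eq_of_mem_sphere ω] using
    norm_inner_le_norm (𝕜 := ℝ) (ω : EuclideanSpace ℝ (Fin p)) v

lemma norm_slice_le_one (T : α → EuclideanSpace ℝ (Fin p)) (x : α) (e : HalfSpace p) :
    ‖slice T x e‖ ≤ 1 := by
  unfold slice step
  split_ifs <;> simp

lemma lintegral_sliceMeasure {F : HalfSpace p → ℝ≥0∞} (hF : Measurable F) :
    ∫⁻ e, F e ∂(sliceMeasure p) = ∫⁻ ω, (∫⁻ t, F (ω, t)) ∂(sphereUniform p) :=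
  lintegral_prod _ hF.aemeasurable

lemma lintegral_inv_one_add_sq_le (p : ℕ) :
    ∫⁻ e : HalfSpace p, ENNReal.ofReal (1 + e.2 ^ 2)⁻¹ ∂(sliceMeasure p)
      ≤ ENNReal.ofReal Real.pi := by
  rw [lintegral_sliceMeasure (by fun_prop)]
  refine lintegral_sphereUniform_le fun _ => ?_
  rw [← integral_univ_inv_one_add_sq,
    ofReal_integral_eq_lintegral_ofReal integrable_inv_one_add_sq
      (.of_forall fun t => by positivity)]

variable [MeasurableSpace α]

lemma measurable_slice (hT : Measurable T) : Measurable (Function.uncurry (slice T)) :=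
  measurable_step.comp <| Measurable.prodMk
    ((measurable_subtype_coe.comp (measurable_fst.comp measurable_snd)).inner
      (hT.comp measurable_fst)) (measurable_snd.comp measurable_snd)

lemma eLpNorm_slice_sub_slice_le (hT : Measurable T) (hT' : Measurable T') (x : α) :
    eLpNorm (slice T x - slice T' x) 1 (sliceMeasure p) ≤ ‖T x - T' x‖ₑ := by
  have hm : Measurable fun e => ‖slice T x e - slice T' x e‖ₑ :=
    (((measurable_slice hT).sub (measurable_slice hT')).comp measurable_prodMk_left).enorm
  rw [eLpNorm_one_eq_lintegral_enorm]
  simp only [Pi.sub_apply]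
  rw [lintegral_sliceMeasure hm]
  refine lintegral_sphereUniform_le fun ω => ?_
  simp only [slice]
  rw [lintegral_enorm_step_sub_step_right, ← inner_sub_right]
  exact enorm_inner_sphere_le ω _

lemma lintegral_enorm_slice_sub_slice_sq_mul_le (hT : Measurable T) (hT' : Measurable T') (x : α) :
    ∫⁻ e, ‖slice T x e - slice T' x e‖ₑ ^ 2 * ENNReal.ofReal (1 + e.2 ^ 2) ∂(sliceMeasure p)
      ≤ ‖T x - T' x‖ₑ * ENNReal.ofReal (1 + ‖T x‖ ^ 2 + ‖T' x‖ ^ 2) := by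
  have hm : Measurable fun e => ‖slice T x e - slice T' x e‖ₑ :=
    (((measurable_slice hT).sub (measurable_slice hT')).comp measurable_prodMk_left).enorm
  rw [lintegral_sliceMeasure (by fun_prop)]
  refine lintegral_sphereUniform_le fun ω => ?_
  have hsq (v : EuclideanSpace ℝ (Fin p)) :
      inner ℝ (ω : EuclideanSpace ℝ (Fin p)) v ^ 2 ≤ ‖v‖ ^ 2 :=
    sq_le_sq.2 (by simpa using enorm_le_iff_norm_le.1 (enorm_inner_sphere_le ω v))
  simp only [slice]
  refine (lintegral_enorm_step_sub_step_sq_mul_le _ _).trans ?_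
  rw [← inner_sub_right]
  exact mul_le_mul' (enorm_inner_sphere_le ω _)
    (ENNReal.ofReal_le_ofReal (by linarith [hsq (T x), hsq (T' x)]))

end Slices

section SlicedDeviation

variable {α : Type*} [MeasurableSpace α] {P : Measure α} [IsProbabilityMeasure P] {p m : ℕ}

lemma isProbabilityMeasure_empirical (hm : 0 < m) (x : Fin m → EuclideanSpace ℝ (Fin p)) :
    IsProbabilityMeasure (empirical x) := by
  refine ⟨?_⟩
  simp only [empirical, Measure.smul_apply, Measure.finsetSum_apply, measure_univ, smul_eq_mul,
    Finset.sum_const, Finset.card_univ, Fintype.card_fin, nsmul_eq_mul, mul_one]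
  exact ENNReal.inv_mul_cancel (by exact_mod_cast hm.ne') (ENNReal.natCast_ne_top m)

lemma isProbabilityMeasure_proj (μ : Measure (EuclideanSpace ℝ (Fin p))) [IsProbabilityMeasure μ]
    (ω : EuclideanSpace ℝ (Fin p)) : IsProbabilityMeasure (proj μ ω) :=
  Measure.isProbabilityMeasure_map (by fun_prop)

lemma proj_real_Iic (μ : Measure (EuclideanSpace ℝ (Fin p))) (ω : EuclideanSpace ℝ (Fin p))
    (t : ℝ) : (proj μ ω).real (Set.Iic t) = ∫ v, step (inner ℝ ω v) t ∂μ := by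
  have hω : Measurable fun v : EuclideanSpace ℝ (Fin p) => inner ℝ ω v := by fun_prop
  rw [proj, map_measureReal_apply hω measurableSet_Iic, ← integral_indicator_one
    (hω measurableSet_Iic)]
  refine integral_congr_ae (.of_forall fun v => ?_)
  by_cases h : inner ℝ ω v ≤ t <;> simp [step, h]

lemma measurable_step_inner (ω : EuclideanSpace ℝ (Fin p)) (t : ℝ) :
    Measurable fun v : EuclideanSpace ℝ (Fin p) => step (inner ℝ ω v) t :=
  measurable_step.comp (Measurable.prodMk (by fun_prop) measurable_const)

lemma integral_empirical (x : Fin m → EuclideanSpace ℝ (Fin p))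
    {φ : EuclideanSpace ℝ (Fin p) → ℝ} (hφ : Measurable φ) :
    ∫ v, φ v ∂(empirical x) = (m : ℝ)⁻¹ * ∑ j, φ (x j) := by
  rw [empirical, integral_smul_measure, integral_finsetSum_measure fun j _ =>
    integrable_dirac' hφ.stronglyMeasurable (by simp)]
  simp [integral_dirac' _ _ hφ.stronglyMeasurable]

theorem slicedW_empirical_le_eLpNorm_deviation (hm : 0 < m) {T : α → EuclideanSpace ℝ (Fin p)}
    (hT : Measurable T) (z : Fin m → α) :
    slicedW (empirical fun j => T (z j)) (P.map T)
      ≤ eLpNorm (deviation P (slice T) z) 1 (sliceMeasure p) := by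
  have hdev : Measurable fun e => ‖deviation P (slice T) z e‖ₑ :=
    ((measurable_deviation (measurable_slice hT)).comp measurable_prodMk_left).enorm
  rw [eLpNorm_one_eq_lintegral_enorm, lintegral_sliceMeasure hdev]
  refine lintegral_mono fun ω => ?_
  have := isProbabilityMeasure_empirical hm fun j => T (z j)
  have := Measure.isProbabilityMeasure_map (μ := P) hT.aemeasurable
  have := isProbabilityMeasure_proj (empirical fun j => T (z j)) ω
  have := isProbabilityMeasure_proj (P.map T) ω
  refine (wasserstein1_le_lintegral_cdf _ _).trans (lintegral_mono fun t => le_of_eq ?_)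
  have hstep := measurable_step_inner (ω : EuclideanSpace ℝ (Fin p)) t
  rw [ProbabilityTheory.cdf_eq_real, ProbabilityTheory.cdf_eq_real, proj_real_Iic, proj_real_Iic,
    integral_empirical _ hstep, integral_map hT.aemeasurable hstep.aestronglyMeasurable]
  simp only [deviation, slice]

end SlicedDeviation

section ExponentialWeights

variable {κ a b d : ℝ}

lemma mul_exp_four_mul_le (hκ : 0 < κ) (hdab : d ≤ a + b) :
    d * Real.exp (4 * κ * (a + b)) ≤ κ⁻¹ * (Real.exp (10 * κ * a) + Real.exp (10 * κ * b)) := by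
  have hlin : a + b ≤ κ⁻¹ * Real.exp (κ * (a + b)) := by
    rw [← div_eq_inv_mul, le_div_iff₀' hκ]
    linarith [Real.add_one_le_exp (κ * (a + b))]
  have hmul : Real.exp (κ * (a + b)) * Real.exp (4 * κ * (a + b))
      = Real.exp (5 * κ * a) * Real.exp (5 * κ * b) := by
    rw [← Real.exp_add, ← Real.exp_add]
    ring_nf
  have hsq (x : ℝ) : Real.exp (5 * κ * x) ^ 2 = Real.exp (10 * κ * x) := by
    rw [← Real.exp_nat_mul]
    ring_nf
  calc d * Real.exp (4 * κ * (a + b))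
      ≤ κ⁻¹ * Real.exp (κ * (a + b)) * Real.exp (4 * κ * (a + b)) := by
        gcongr
        exact hdab.trans hlin
    _ = κ⁻¹ * (Real.exp (5 * κ * a) * Real.exp (5 * κ * b)) := by rw [mul_assoc, hmul]
    _ ≤ κ⁻¹ * (Real.exp (10 * κ * a) + Real.exp (10 * κ * b)) := by
        rw [← hsq, ← hsq]
        gcongr
        nlinarith [two_mul_le_add_sq (Real.exp (5 * κ * a)) (Real.exp (5 * κ * b)),
          sq_nonneg (Real.exp (5 * κ * a)), sq_nonneg (Real.exp (5 * κ * b))]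

lemma mul_exp_two_mul_le {c β : ℝ} (hβ : 0 < β) (hd : 0 ≤ d) :
    d * Real.exp (2 * c) ≤ (β ^ 2)⁻¹ * d + β ^ 2 * (d * Real.exp (4 * c)) := by
  have hsq : Real.exp (4 * c) = Real.exp (2 * c) ^ 2 := by
    rw [← Real.exp_nat_mul]
    ring_nf
  have hamgm : Real.exp (2 * c) ≤ (β ^ 2)⁻¹ + β ^ 2 * Real.exp (2 * c) ^ 2 := by
    have h := two_mul_le_add_sq β⁻¹ (β * Real.exp (2 * c))
    have hβ' : 2 * β⁻¹ * (β * Real.exp (2 * c)) = 2 * Real.exp (2 * c) := by field_simp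
    rw [hβ', inv_pow, mul_pow] at h
    linarith [Real.exp_pos (2 * c)]
  calc d * Real.exp (2 * c) ≤ d * ((β ^ 2)⁻¹ + β ^ 2 * Real.exp (2 * c) ^ 2) := by gcongr
    _ = (β ^ 2)⁻¹ * d + β ^ 2 * (d * Real.exp (4 * c)) := by rw [hsq]; ring

lemma sq_mul_exp_le (hκ : 0 < κ) (hd : 0 ≤ d) (hdab : d ≤ a + b) :
    d ^ 2 * Real.exp (κ * d) ≤ κ⁻¹ * (d * Real.exp (2 * (κ * (a + b)))) := by
  have hexp : Real.exp (κ * d) ≤ Real.exp (κ * (a + b)) := by gcongr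
  have hlin : d ≤ κ⁻¹ * Real.exp (κ * (a + b)) := by
    rw [← div_eq_inv_mul, le_div_iff₀' hκ]
    linarith [Real.add_one_le_exp (κ * d)]
  calc d ^ 2 * Real.exp (κ * d) = d * (d * Real.exp (κ * d)) := by ring
    _ ≤ d * (κ⁻¹ * Real.exp (κ * (a + b)) * Real.exp (κ * (a + b))) := by gcongr
    _ = κ⁻¹ * (d * Real.exp (2 * (κ * (a + b)))) := by rw [two_mul, Real.exp_add]; ring

lemma mul_one_add_sq_add_sq_le (hκ : 0 < κ) (ha : 0 ≤ a) (hb : 0 ≤ b) (hd : 0 ≤ d) :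
    d * (1 + a ^ 2 + b ^ 2) ≤ (1 + 2 / κ ^ 2) * (d * Real.exp (2 * (κ * (a + b)))) := by
  have ht : 0 ≤ κ * (a + b) := by positivity
  have hone : 1 ≤ Real.exp (2 * (κ * (a + b))) := Real.one_le_exp (by positivity)
  have hsq : a ^ 2 + b ^ 2 ≤ 2 / κ ^ 2 * Real.exp (2 * (κ * (a + b))) := by
    have hquad := Real.quadratic_le_exp_of_nonneg ht
    have hmono : Real.exp (κ * (a + b)) ≤ Real.exp (2 * (κ * (a + b))) :=
      Real.exp_le_exp.2 (by linarith)
    rw [div_mul_eq_mul_div, le_div_iff₀ (by positivity)]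
    nlinarith [mul_nonneg ha hb, sq_nonneg κ, mul_nonneg (mul_nonneg ha hb) (sq_nonneg κ)]
  calc d * (1 + a ^ 2 + b ^ 2)
      ≤ d * (Real.exp (2 * (κ * (a + b))) + 2 / κ ^ 2 * Real.exp (2 * (κ * (a + b)))) := by
        refine mul_le_mul_of_nonneg_left ?_ hd
        linarith
    _ = (1 + 2 / κ ^ 2) * (d * Real.exp (2 * (κ * (a + b)))) := by ring

end ExponentialWeights

section Increments

variable {α : Type*} [MeasurableSpace α] {P : Measure α} {p : ℕ}
  {T T' : α → EuclideanSpace ℝ (Fin p)} {κ M β : ℝ}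

/-- The random vector `T` has an exponential moment of rate `c` bounded by `M`. -/
structure ExpMomentLE (P : Measure α) (T : α → EuclideanSpace ℝ (Fin p)) (c M : ℝ) : Prop where
  measurable : Measurable T
  integrable : Integrable (fun x => Real.exp (c * ‖T x‖)) P
  integral_le : ∫ x, Real.exp (c * ‖T x‖) ∂P ≤ M

lemma ExpMomentLE.nonneg {c : ℝ} (hT : ExpMomentLE P T c M) : 0 ≤ M :=
  (integral_nonneg fun _ => (Real.exp_pos _).le).trans hT.integral_le

lemma ExpMomentLE.integral_norm_le {c : ℝ} (hc : 0 < c) (hT : ExpMomentLE P T c M) :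
    ∫ x, ‖T x‖ ∂P ≤ M / c := by
  calc ∫ x, ‖T x‖ ∂P ≤ ∫ x, Real.exp (c * ‖T x‖) / c ∂P := by
        refine integral_mono_of_nonneg (.of_forall fun x => norm_nonneg _)
          (hT.integrable.div_const c) (.of_forall fun x => ?_)
        rw [le_div_iff₀' hc]
        linarith [Real.add_one_le_exp (c * ‖T x‖)]
    _ ≤ M / c := by
        rw [integral_div]
        gcongr
        exact hT.integral_le

lemma integrable_norm_sub_mul_exp_four (hκ : 0 < κ) (hT : ExpMomentLE P T (10 * κ) M)
    (hT' : ExpMomentLE P T' (10 * κ) M) :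
    Integrable (fun x => ‖T x - T' x‖ * Real.exp (4 * κ * (‖T x‖ + ‖T' x‖))) P := by
  have := hT.measurable
  have := hT'.measurable
  refine ((hT.integrable.add hT'.integrable).const_mul κ⁻¹).mono'
    (by fun_prop) (.of_forall fun x => ?_)
  rw [Real.norm_of_nonneg (by positivity)]
  exact mul_exp_four_mul_le hκ (norm_sub_le _ _)

lemma integrable_norm_sub_mul_exp_two (hκ : 0 < κ) (hT : ExpMomentLE P T (10 * κ) M)
    (hT' : ExpMomentLE P T' (10 * κ) M) :
    Integrable (fun x => ‖T x - T' x‖ * Real.exp (2 * (κ * (‖T x‖ + ‖T' x‖)))) P := by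
  have := hT.measurable
  have := hT'.measurable
  refine (integrable_norm_sub_mul_exp_four hκ hT hT').mono' (by fun_prop) (.of_forall fun x => ?_)
  rw [Real.norm_of_nonneg (by positivity), mul_assoc 4]
  gcongr
  norm_num

lemma integrable_norm_sub (hκ : 0 < κ) (hT : ExpMomentLE P T (10 * κ) M)
    (hT' : ExpMomentLE P T' (10 * κ) M) : Integrable (fun x => ‖T x - T' x‖) P := by
  have := hT.measurable
  have := hT'.measurable
  refine (integrable_norm_sub_mul_exp_two hκ hT hT').mono' (by fun_prop) (.of_forall fun x => ?_)
  rw [norm_norm]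
  exact le_mul_of_one_le_right (norm_nonneg _) (Real.one_le_exp (by positivity))

lemma integral_norm_sub_mul_exp_two_le (hκ : 0 < κ) (hβ : 0 < β)
    (hT : ExpMomentLE P T (10 * κ) M) (hT' : ExpMomentLE P T' (10 * κ) M)
    (hdist : ∫ x, ‖T x - T' x‖ ∂P ≤ β ^ 4) :
    ∫ x, ‖T x - T' x‖ * Real.exp (2 * (κ * (‖T x‖ + ‖T' x‖))) ∂P ≤ β ^ 2 * (1 + 2 * M / κ) := by
  have hint4 := integrable_norm_sub_mul_exp_four hκ hT hT'
  have hint := integrable_norm_sub hκ hT hT'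
  have hfour : ∫ x, ‖T x - T' x‖ * Real.exp (4 * κ * (‖T x‖ + ‖T' x‖)) ∂P ≤ κ⁻¹ * (M + M) := by
    calc ∫ x, ‖T x - T' x‖ * Real.exp (4 * κ * (‖T x‖ + ‖T' x‖)) ∂P
        ≤ ∫ x, κ⁻¹ * (Real.exp (10 * κ * ‖T x‖) + Real.exp (10 * κ * ‖T' x‖)) ∂P :=
          integral_mono hint4 ((hT.integrable.add hT'.integrable).const_mul _) fun x =>
            mul_exp_four_mul_le hκ (norm_sub_le _ _)
      _ ≤ κ⁻¹ * (M + M) := by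
          rw [integral_const_mul, integral_add hT.integrable hT'.integrable]
          have := hT.integral_le
          have := hT'.integral_le
          gcongr
  calc ∫ x, ‖T x - T' x‖ * Real.exp (2 * (κ * (‖T x‖ + ‖T' x‖))) ∂P
      ≤ ∫ x, ((β ^ 2)⁻¹ * ‖T x - T' x‖
          + β ^ 2 * (‖T x - T' x‖ * Real.exp (4 * κ * (‖T x‖ + ‖T' x‖)))) ∂P := by
        refine integral_mono (integrable_norm_sub_mul_exp_two hκ hT hT')
          ((hint.const_mul _).add (hint4.const_mul _)) fun x => ?_
        rw [mul_assoc 4]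
        exact mul_exp_two_mul_le hβ (norm_nonneg _)
    _ ≤ (β ^ 2)⁻¹ * β ^ 4 + β ^ 2 * (κ⁻¹ * (M + M)) := by
        rw [integral_add (hint.const_mul _) (hint4.const_mul _), integral_const_mul,
          integral_const_mul]
        gcongr
    _ = β ^ 2 * (1 + 2 * M / κ) := by field_simp; ring

lemma integrable_norm_sub_sq_mul_exp (hκ : 0 < κ) (hT : ExpMomentLE P T (10 * κ) M)
    (hT' : ExpMomentLE P T' (10 * κ) M) :
    Integrable (fun x => ‖T x - T' x‖ ^ 2 * Real.exp (κ * ‖T x - T' x‖)) P := by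
  have := hT.measurable
  have := hT'.measurable
  refine ((integrable_norm_sub_mul_exp_two hκ hT hT').const_mul κ⁻¹).mono' (by fun_prop)
    (.of_forall fun x => ?_)
  rw [Real.norm_of_nonneg (by positivity)]
  exact sq_mul_exp_le hκ (norm_nonneg _) (norm_sub_le _ _)

lemma integral_norm_sub_sq_mul_exp_le (hκ : 0 < κ) (hβ : 0 < β)
    (hT : ExpMomentLE P T (10 * κ) M) (hT' : ExpMomentLE P T' (10 * κ) M)
    (hdist : ∫ x, ‖T x - T' x‖ ∂P ≤ β ^ 4) :
    ∫ x, ‖T x - T' x‖ ^ 2 * Real.exp (κ * ‖T x - T' x‖) ∂P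
      ≤ κ⁻¹ * (β ^ 2 * (1 + 2 * M / κ)) := by
  calc ∫ x, ‖T x - T' x‖ ^ 2 * Real.exp (κ * ‖T x - T' x‖) ∂P
      ≤ ∫ x, κ⁻¹ * (‖T x - T' x‖ * Real.exp (2 * (κ * (‖T x‖ + ‖T' x‖)))) ∂P :=
        integral_mono (integrable_norm_sub_sq_mul_exp hκ hT hT')
          ((integrable_norm_sub_mul_exp_two hκ hT hT').const_mul _) fun x =>
            sq_mul_exp_le hκ (norm_nonneg _) (norm_sub_le _ _)
    _ ≤ κ⁻¹ * (β ^ 2 * (1 + 2 * M / κ)) := by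
        rw [integral_const_mul]
        gcongr
        exact integral_norm_sub_mul_exp_two_le hκ hβ hT hT' hdist

lemma lintegral_lintegral_slice_sub_slice_le (hκ : 0 < κ) (hβ : 0 < β)
    (hT : ExpMomentLE P T (10 * κ) M) (hT' : ExpMomentLE P T' (10 * κ) M)
    (hdist : ∫ x, ‖T x - T' x‖ ∂P ≤ β ^ 4) :
    ∫⁻ x, ∫⁻ e, ‖(slice T - slice T') x e‖ₑ ^ 2 * ENNReal.ofReal (1 + e.2 ^ 2)
        ∂(sliceMeasure p) ∂P
      ≤ ENNReal.ofReal ((1 + 2 / κ ^ 2) * (β ^ 2 * (1 + 2 * M / κ))) := by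
  calc ∫⁻ x, ∫⁻ e, ‖(slice T - slice T') x e‖ₑ ^ 2 * ENNReal.ofReal (1 + e.2 ^ 2)
        ∂(sliceMeasure p) ∂P
      ≤ ∫⁻ x, ENNReal.ofReal ((1 + 2 / κ ^ 2)
          * (‖T x - T' x‖ * Real.exp (2 * (κ * (‖T x‖ + ‖T' x‖))))) ∂P := by
        refine lintegral_mono fun x =>
          (lintegral_enorm_slice_sub_slice_sq_mul_le hT.measurable hT'.measurable x).trans ?_
        rw [← ofReal_norm, ← ENNReal.ofReal_mul (norm_nonneg _)]
        exact ENNReal.ofReal_le_ofReal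
          (mul_one_add_sq_add_sq_le hκ (norm_nonneg _) (norm_nonneg _) (norm_nonneg _))
    _ = ENNReal.ofReal ((1 + 2 / κ ^ 2)
          * ∫ x, ‖T x - T' x‖ * Real.exp (2 * (κ * (‖T x‖ + ‖T' x‖))) ∂P) := by
        rw [← ofReal_integral_eq_lintegral_ofReal
          ((integrable_norm_sub_mul_exp_two hκ hT hT').const_mul _)
          (.of_forall fun x => by positivity), integral_const_mul]
    _ ≤ ENNReal.ofReal ((1 + 2 / κ ^ 2) * (β ^ 2 * (1 + 2 * M / κ))) := by
        gcongr
        exact integral_norm_sub_mul_exp_two_le hκ hβ hT hT' hdist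

variable [IsProbabilityMeasure P] {m : ℕ}

lemma memLp_slice_sub_slice (hT : Measurable T) (hT' : Measurable T') (e : HalfSpace p) :
    MemLp (fun x => (slice T - slice T') x e) 2 P := by
  have hslice {S : α → EuclideanSpace ℝ (Fin p)} (hS : Measurable S) :
      MemLp (fun x => slice S x e) 2 P :=
    .of_bound ((measurable_slice hS).comp measurable_prodMk_right).aestronglyMeasurable 1
      (.of_forall fun x => norm_slice_le_one S x e)
  exact (hslice hT).sub (hslice hT')

lemma memLp_deviation_slice_sub_slice (hκ : 0 < κ) (hT : ExpMomentLE P T (10 * κ) M)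
    (hT' : ExpMomentLE P T' (10 * κ) M) (z : Fin m → α) :
    MemLp (deviation P (slice T - slice T') z) 1 (sliceMeasure p) :=
  memLp_deviation ((measurable_slice hT.measurable).sub (measurable_slice hT'.measurable))
    (fun _ => norm_nonneg _) (integrable_norm_sub hκ hT hT')
    (fun x => (eLpNorm_slice_sub_slice_le hT.measurable hT'.measurable x).trans_eq
      (ofReal_norm _).symm) z

lemma sqrt_mul_integral_eLpNorm_deviation_slice_le (hκ : 0 < κ) (hβ : 0 < β)
    (hT : ExpMomentLE P T (10 * κ) M) (hT' : ExpMomentLE P T' (10 * κ) M)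
    (hdist : ∫ x, ‖T x - T' x‖ ∂P ≤ β ^ 4) (hm : 0 < m) :
    √m * ∫ z : Fin m → α, (eLpNorm (deviation P (slice T - slice T') z) 1 (sliceMeasure p)).toReal
        ∂(Measure.pi fun _ => P)
      ≤ β * ((1 + 2 / κ ^ 2) * (1 + 2 * M / κ) + Real.pi) := by
  have : 0 ≤ M := hT.nonneg
  have hmeas : Measurable (Function.uncurry (slice T - slice T')) :=
    (measurable_slice hT.measurable).sub (measurable_slice hT'.measurable)
  rw [integral_toReal (measurable_eLpNorm_deviation hmeas).aemeasurable
      (.of_forall fun z => (memLp_deviation_slice_sub_slice hκ hT hT' z).2),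
    ← ENNReal.toReal_ofReal (Real.sqrt_nonneg m), ← ENNReal.toReal_mul]
  refine ENNReal.toReal_le_of_le_ofReal (by positivity) ?_
  calc _ ≤ ENNReal.ofReal β⁻¹ * ENNReal.ofReal ((1 + 2 / κ ^ 2) * (β ^ 2 * (1 + 2 * M / κ)))
        + ENNReal.ofReal β⁻¹⁻¹ * ENNReal.ofReal Real.pi := by
        refine (lintegral_eLpNorm_deviation_le hm hmeas
          (memLp_slice_sub_slice hT.measurable hT'.measurable)
          (w := fun e : HalfSpace p => 1 + e.2 ^ 2) (by fun_prop) (fun e => by positivity)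
          (inv_pos.2 hβ)).trans ?_
        gcongr
        · exact lintegral_lintegral_slice_sub_slice_le hκ hβ hT hT' hdist
        · exact lintegral_inv_one_add_sq_le p
    _ = ENNReal.ofReal (β * ((1 + 2 / κ ^ 2) * (1 + 2 * M / κ) + Real.pi)) := by
        rw [inv_inv, ← ENNReal.ofReal_mul (by positivity), ← ENNReal.ofReal_mul hβ.le,
          ← ENNReal.ofReal_add (by positivity) (by positivity)]
        congr 1
        field_simp

/-- A bound for the logarithm of the exponential moments of the normalized slice deviations, for
maps with exponential moments of rate `10 κ` bounded by `M`. -/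
def logMomentBound (κ M : ℝ) : ℝ :=
  (1 + 2 / κ ^ 2 + 4 / κ) * (1 + 2 * M / κ) + Real.pi

theorem lintegral_exp_eLpNorm_deviation_slice_le (hκ : 0 < κ) (hβ : 0 < β)
    (hT : ExpMomentLE P T (10 * κ) M) (hT' : ExpMomentLE P T' (10 * κ) M)
    (hdist : ∫ x, ‖T x - T' x‖ ∂P ≤ β ^ 4) (hm : 0 < m) (hβm : 2 * β⁻¹ ≤ κ * √m) :
    ∫⁻ z : Fin m → α, ENNReal.ofReal (Real.exp (β⁻¹ * (√m *
        (eLpNorm (deviation P (slice T - slice T') z) 1 (sliceMeasure p)).toReal)))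
          ∂(Measure.pi fun _ => P)
      ≤ ENNReal.ofReal (Real.exp (logMomentBound κ M)) := by
  have : 0 ≤ M := hT.nonneg
  have hmeas : Measurable (Function.uncurry (slice T - slice T')) :=
    (measurable_slice hT.measurable).sub (measurable_slice hT'.measurable)
  have hsq := integral_norm_sub_sq_mul_exp_le hκ hβ hT hT' hdist
  refine (lintegral_exp_eLpNorm_deviation_le hmeas (fun x => norm_nonneg _)
    (integrable_norm_sub hκ hT hT') (fun x => (eLpNorm_slice_sub_slice_le hT.measurable
      hT'.measurable x).trans_eq (ofReal_norm _).symm)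
    (integrable_norm_sub_sq_mul_exp hκ hT hT') hm (inv_nonneg.2 hβ.le) hβm).trans ?_
  refine ENNReal.ofReal_le_ofReal (Real.exp_le_exp.2 ?_)
  calc _ ≤ β⁻¹ * (β * ((1 + 2 / κ ^ 2) * (1 + 2 * M / κ) + Real.pi))
        + 4 * β⁻¹ ^ 2 * (κ⁻¹ * (β ^ 2 * (1 + 2 * M / κ))) := by
        exact add_le_add (mul_le_mul_of_nonneg_left
          (sqrt_mul_integral_eLpNorm_deviation_slice_le hκ hβ hT hT' hdist hm)
          (inv_nonneg.2 hβ.le)) (by gcongr)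
    _ = logMomentBound κ M := by
        rw [logMomentBound]
        field_simp
        ring

end Increments

section Maximal

variable {Ω ι : Type*} [MeasurableSpace Ω] {P : Measure Ω}

lemma le_mul_log_add_mul_exp {A β : ℝ} (hA : 0 < A) (hβ : 0 < β) (y : ℝ) :
    y ≤ β * Real.log A + β / A * Real.exp (β⁻¹ * y) := by
  have hlog := Real.log_le_self (x := Real.exp (β⁻¹ * y) / A) (by positivity)
  rw [Real.log_div (Real.exp_pos _).ne' hA.ne', Real.log_exp] at hlog
  calc y = β * (β⁻¹ * y) := by field_simp
    _ ≤ β * (Real.log A + Real.exp (β⁻¹ * y) / A) := by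
        gcongr
        linarith
    _ = β * Real.log A + β / A * Real.exp (β⁻¹ * y) := by ring

lemma lintegral_biSup_ofReal_le [IsProbabilityMeasure P] {N : Finset ι} {Y : ι → Ω → ℝ}
    (hY : ∀ i ∈ N, Measurable (Y i)) {β C : ℝ} (hβ : 0 < β) (hC : 0 ≤ C)
    (hexp : ∀ i ∈ N, ∫⁻ z, ENNReal.ofReal (Real.exp (β⁻¹ * Y i z)) ∂P
      ≤ ENNReal.ofReal (Real.exp C)) :
    ∫⁻ z, ⨆ i ∈ N, ENNReal.ofReal (Y i z) ∂P
      ≤ ENNReal.ofReal (β * (Real.log N.card + C + 1)) := by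
  rcases N.eq_empty_or_nonempty with rfl | hN
  · simp
  have hcard : (0 : ℝ) < N.card := by exact_mod_cast hN.card_pos
  have : 0 ≤ Real.log N.card := Real.log_natCast_nonneg _
  set A : ℝ := N.card * Real.exp C with hA
  have hlogA : Real.log A = Real.log N.card + C := by
    rw [hA, Real.log_mul hcard.ne' (Real.exp_pos _).ne', Real.log_exp]
  calc ∫⁻ z, ⨆ i ∈ N, ENNReal.ofReal (Y i z) ∂P
      ≤ ∫⁻ z, (ENNReal.ofReal (β * Real.log A)
          + ENNReal.ofReal (β / A) * ∑ i ∈ N, ENNReal.ofReal (Real.exp (β⁻¹ * Y i z))) ∂P := by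
        refine lintegral_mono fun z => iSup₂_le fun i hi => ?_
        refine (ENNReal.ofReal_le_ofReal
          (le_mul_log_add_mul_exp (by positivity : 0 < A) hβ _)).trans
            (ENNReal.ofReal_add_le.trans ?_)
        rw [ENNReal.ofReal_mul (p := β / A) (by positivity)]
        gcongr
        exact Finset.single_le_sum (f := fun i => ENNReal.ofReal (Real.exp (β⁻¹ * Y i z)))
          (fun _ _ => zero_le) hi
    _ = ENNReal.ofReal (β * Real.log A)
          + ENNReal.ofReal (β / A) * ∑ i ∈ N, ∫⁻ z, ENNReal.ofReal (Real.exp (β⁻¹ * Y i z)) ∂P := by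
        rw [lintegral_add_left measurable_const, lintegral_const_mul' _ _ ENNReal.ofReal_ne_top,
          lintegral_finsetSum N fun i hi => ((hY i hi).const_mul _).exp.ennreal_ofReal,
          lintegral_const, measure_univ, mul_one]
    _ ≤ ENNReal.ofReal (β * Real.log A)
          + ENNReal.ofReal (β / A) * ∑ _i ∈ N, ENNReal.ofReal (Real.exp C) := by
        gcongr with i hi
        exact hexp i hi
    _ = ENNReal.ofReal (β * (Real.log N.card + C + 1)) := by
        rw [Finset.sum_const, nsmul_eq_mul, ← ENNReal.ofReal_natCast,
          ← ENNReal.ofReal_mul hcard.le, ← ENNReal.ofReal_mul (by positivity),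
          ← ENNReal.ofReal_add (by rw [hlogA]; positivity) (by positivity), hlogA]
        congr 1
        rw [hA]
        field_simp

lemma lintegral_biSup_le_sum_range {Y : ι → Ω → ℝ≥0∞} (hY : ∀ i, Measurable (Y i))
    {D : ℕ → ι → Ω → ℝ≥0∞} {N : ℕ → Finset ι} {π : ℕ → ι → ι} (hπ : ∀ k i, π k i ∈ N k)
    (hlink : ∀ k i z, Y i z ≤ D k i z + Y (π k i) z) {a : ℕ → ℝ≥0∞}
    (hbase : ∫⁻ z, ⨆ i ∈ N 0, Y i z ∂P ≤ a 0) {n : ℕ}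
    (hstep : ∀ k < n, ∫⁻ z, ⨆ i ∈ N (k + 1), D k i z ∂P ≤ a (k + 1)) :
    ∫⁻ z, ⨆ i ∈ N n, Y i z ∂P ≤ ∑ k ∈ Finset.range (n + 1), a k := by
  induction n with
  | zero => simpa using hbase
  | succ n ih =>
    rw [Finset.sum_range_succ, add_comm _ (a _)]
    calc ∫⁻ z, ⨆ i ∈ N (n + 1), Y i z ∂P
        ≤ ∫⁻ z, ((⨆ i ∈ N (n + 1), D n i z) + ⨆ i ∈ N n, Y i z) ∂P :=
          lintegral_mono fun z => iSup₂_le fun i hi => (hlink n i z).trans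
            (add_le_add (le_iSup₂_of_le i hi le_rfl) (le_iSup₂_of_le (π n i) (hπ n i) le_rfl))
      _ = ∫⁻ z, ⨆ i ∈ N (n + 1), D n i z ∂P + ∫⁻ z, ⨆ i ∈ N n, Y i z ∂P :=
          lintegral_add_right _ (Measurable.biSup _ (N n).countable_toSet fun i _ => hY i)
      _ ≤ a (n + 1) + ∑ k ∈ Finset.range (n + 1), a k :=
          add_le_add (hstep n n.lt_succ_self) (ih fun k hk => hstep k (hk.trans n.lt_succ_self))

end Maximal

section Nets

open Metric

variable {F : Type*} [NormedAddCommGroup F] [NormedSpace ℝ F] [FiniteDimensional ℝ F]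

lemma card_le_of_isSeparated {s : Finset F} {R : ℝ} {ε : ℝ≥0} (hε : 0 < ε)
    (hR0 : 0 ≤ R) (hR : ∀ x ∈ s, ‖x‖ ≤ R) (hs : IsSeparated ε (s : Set F)) :
    (s.card : ℝ) ≤ (1 + 2 * R / ε) ^ Module.finrank ℝ F := by
  borelize F
  let μ : Measure F := Measure.addHaar
  have hε2 : (0 : ℝ) < ε / 2 := by positivity
  have hball : 0 < R + ε / 2 := by positivity
  have hdisj : (s : Set F).PairwiseDisjoint fun x => ball x (ε / 2) := fun x hx y hy hxy => by
    refine ball_disjoint_ball ?_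
    have hsep : (ε : ℝ≥0∞) < edist x y := hs hx hy hxy
    rw [edist_nndist, ENNReal.coe_lt_coe] at hsep
    rw [add_halves]
    exact_mod_cast hsep.le
  have hvol : s.card * ENNReal.ofReal ((ε / 2) ^ Module.finrank ℝ F) * μ (ball 0 1)
      ≤ ENNReal.ofReal ((R + ε / 2) ^ Module.finrank ℝ F) * μ (ball 0 1) := by
    calc _ = μ (⋃ x ∈ s, ball x (ε / 2)) := by
          rw [measure_biUnion_finset hdisj fun x _ => measurableSet_ball]
          simp only [μ.addHaar_ball_of_pos _ hε2, Finset.sum_const, nsmul_eq_mul, mul_assoc]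
      _ ≤ μ (ball 0 (R + ε / 2)) := by
          refine measure_mono (Set.iUnion₂_subset fun x hx => ball_subset_ball' ?_)
          rw [dist_zero_right]
          linarith [hR x hx]
      _ = _ := μ.addHaar_ball_of_pos _ hball
  rw [ENNReal.mul_le_mul_iff_left (measure_ball_pos _ _ zero_lt_one).ne' measure_ball_lt_top.ne]
    at hvol
  have hcard : s.card * ((ε : ℝ) / 2) ^ Module.finrank ℝ F
      ≤ (R + ε / 2) ^ Module.finrank ℝ F := by
    simpa [hε2.le] using ENNReal.toReal_le_of_le_ofReal (by positivity) hvol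
  have hratio : (R + ε / 2) / (ε / 2) = 1 + 2 * R / ε := by
    field_simp
    ring
  rwa [← hratio, div_pow, le_div_iff₀ (by positivity)]

lemma packingNumber_le {Θ : Set F} {R : ℝ} {ε : ℝ≥0} (hε : 0 < ε) (hR0 : 0 ≤ R)
    (hR : ∀ x ∈ Θ, ‖x‖ ≤ R) :
    packingNumber ε Θ ≤ ⌊(1 + 2 * R / ε) ^ Module.finrank ℝ F⌋₊ := by
  refine iSup₂_le fun C hC => iSup_le fun hsep => ?_
  by_contra! hlt
  obtain ⟨t, htC, htcard⟩ := Set.exists_subset_encard_eq (Order.add_one_le_of_lt hlt)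
  obtain ⟨s, rfl⟩ := (Set.finite_of_encard_eq_coe (by exact_mod_cast htcard)).exists_finset_coe
  rw [Set.encard_coe_eq_coe_finsetCard] at htcard
  have hcard : s.card = ⌊(1 + 2 * R / ε) ^ Module.finrank ℝ F⌋₊ + 1 := by exact_mod_cast htcard
  have hle := card_le_of_isSeparated hε hR0 (fun x hx => hR x (hC (htC hx)))
    (hsep.mono htC)
  have hfloor := Nat.le_floor hle
  omega

lemma exists_finset_card_le_dist_le {Θ : Set F} {R : ℝ} {ε : ℝ≥0} (hε : 0 < ε)
    (hR0 : 0 ≤ R) (hR : ∀ x ∈ Θ, ‖x‖ ≤ R) :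
    ∃ N : Finset Θ, N.card ≤ (1 + 2 * R / ε) ^ Module.finrank ℝ F ∧
      ∀ θ, ∃ θ' ∈ N, dist θ θ' ≤ ε := by
  have hpack := packingNumber_le hε hR0 hR
  have htop : packingNumber ε Θ ≠ ⊤ := (hpack.trans_lt (ENat.natCast_lt_top _)).ne
  have hcard := (encard_maximalSeparatedSet htop).trans_le hpack
  obtain ⟨N, hN⟩ := (Set.finite_of_encard_le_coe hcard).exists_finset_coe
  have hsub : ∀ x ∈ N, x ∈ Θ := fun x hx =>
    maximalSeparatedSet_subset (hN ▸ Finset.mem_coe.2 hx)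
  have hcover : IsCover ε Θ (N : Set F) := hN ▸ isCover_maximalSeparatedSet htop
  rw [← hN, Set.encard_coe_eq_coe_finsetCard, Nat.cast_le] at hcard
  classical
  refine ⟨N.subtype (· ∈ Θ), ?_, fun θ => ?_⟩
  · rw [Finset.card_subtype, Finset.filter_true_of_mem hsub]
    exact (Nat.cast_le.2 hcard).trans (Nat.floor_le (by positivity))
  · obtain ⟨x, hx, hdist⟩ := hcover θ.2
    exact ⟨⟨x, hsub x hx⟩, by simpa using hx, edist_le_coe.1 hdist⟩

lemma exists_geometric_nets {Θ : Set F} (hΘ : Bornology.IsBounded Θ) {q : ℝ} (hq : 1 ≤ q) :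
    ∃ c : ℝ, 0 ≤ c ∧ ∀ k : ℕ, ∃ N : Finset Θ, Real.log N.card ≤ c * (k + 1) ∧
      ∀ θ, ∃ θ' ∈ N, dist θ θ' ≤ (q ^ k)⁻¹ := by
  obtain ⟨R, hR0, hR⟩ := hΘ.exists_pos_norm_le
  have hlogR : 0 ≤ Real.log (1 + 2 * R) := Real.log_nonneg (by linarith)
  have hlogq : 0 ≤ Real.log q := Real.log_nonneg hq
  refine ⟨Module.finrank ℝ F * (Real.log (1 + 2 * R) + Real.log q), by positivity, fun k => ?_⟩
  have hqk : 1 ≤ q ^ k := one_le_pow₀ hq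
  have hε : (((q ^ k)⁻¹).toNNReal : ℝ) = (q ^ k)⁻¹ := Real.coe_toNNReal _ (by positivity)
  obtain ⟨N, hcard, hnet⟩ := exists_finset_card_le_dist_le (ε := ((q ^ k)⁻¹).toNNReal)
    (Real.toNNReal_pos.2 (by positivity)) hR0.le hR
  simp only [hε, div_inv_eq_mul] at hcard hnet
  refine ⟨N, ?_, hnet⟩
  rcases N.eq_empty_or_nonempty with rfl | hN
  · simp only [Finset.card_empty, Nat.cast_zero, Real.log_zero]
    positivity
  calc Real.log N.card ≤ Real.log (((1 + 2 * R) * q ^ k) ^ Module.finrank ℝ F) := by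
        refine Real.log_le_log (by exact_mod_cast hN.card_pos) (hcard.trans ?_)
        gcongr
        linarith
    _ = Module.finrank ℝ F * (Real.log (1 + 2 * R) + k * Real.log q) := by
        rw [Real.log_pow, Real.log_mul (by positivity) (by positivity), Real.log_pow]
    _ ≤ Module.finrank ℝ F * (Real.log (1 + 2 * R) + Real.log q) * (k + 1) := by
        rw [mul_assoc]
        gcongr
        nlinarith [k.cast_nonneg (α := ℝ)]

end Nets

section GeometricScales

lemma sum_succ_div_two_pow_le (n : ℕ) :
    ∑ k ∈ Finset.range (n + 1), ((k : ℝ) + 1) / 2 ^ k ≤ 4 := by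
  have hsum : ∑ k ∈ Finset.range (n + 1), ((k : ℝ) + 1) / 2 ^ k = 4 - (n + 3) / 2 ^ n := by
    induction n with
    | zero => norm_num
    | succ n ih =>
      rw [Finset.sum_range_succ, ih, pow_succ]
      push_cast
      field_simp
      ring
  rw [hsum]
  linarith [show (0 : ℝ) ≤ (n + 3) / 2 ^ n by positivity]

lemma sum_range_ofReal_div_two_pow_mul_le {b c C : ℝ} {ℓ : ℕ → ℝ} (hb : 0 ≤ b) (hC : 0 ≤ C)
    (hc : 0 ≤ c) (hℓ : ∀ k : ℕ, ℓ k ≤ c * (k + 1)) (n : ℕ) :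
    ∑ k ∈ Finset.range (n + 1), ENNReal.ofReal (b / 2 ^ k * (ℓ k + C + 1))
      ≤ ENNReal.ofReal (4 * (b * (c + C + 1))) := by
  have hterm (k : ℕ) : b / 2 ^ k * (ℓ k + C + 1) ≤ b * (c + C + 1) * ((k + 1) / 2 ^ k) := by
    calc b / 2 ^ k * (ℓ k + C + 1) ≤ b / 2 ^ k * ((c + C + 1) * (k + 1)) := by
          gcongr
          nlinarith [hℓ k, k.cast_nonneg (α := ℝ)]
      _ = b * (c + C + 1) * ((k + 1) / 2 ^ k) := by ring
  calc ∑ k ∈ Finset.range (n + 1), ENNReal.ofReal (b / 2 ^ k * (ℓ k + C + 1))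
      ≤ ∑ k ∈ Finset.range (n + 1), ENNReal.ofReal (b * (c + C + 1) * ((k + 1) / 2 ^ k)) := by
        exact Finset.sum_le_sum fun k _ => ENNReal.ofReal_le_ofReal (hterm k)
    _ = ENNReal.ofReal (b * (c + C + 1) * ∑ k ∈ Finset.range (n + 1), ((k : ℝ) + 1) / 2 ^ k) := by
        rw [← ENNReal.ofReal_sum_of_nonneg fun k _ => by positivity, Finset.mul_sum]
    _ ≤ ENNReal.ofReal (4 * (b * (c + C + 1))) := by
        rw [mul_comm 4]
        gcongr
        exact sum_succ_div_two_pow_le n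

lemma two_mul_inv_div_two_pow_le {κ b r : ℝ} (hκ : 0 < κ) (hb : 4 / κ ≤ b) {k : ℕ}
    (hk : 2 ^ k ≤ 2 * r) : 2 * (b / 2 ^ k)⁻¹ ≤ κ * r := by
  have hb0 : 0 < b := (by positivity : 0 < 4 / κ).trans_le hb
  have hr : 0 < r := by linarith [show (0 : ℝ) < 2 ^ k by positivity]
  rw [div_le_iff₀ hκ] at hb
  rw [inv_div, mul_div_assoc', div_le_iff₀ hb0]
  nlinarith [mul_le_mul_of_nonneg_left hb hr.le]

lemma exists_two_pow_near {r : ℝ} (hr : 1 ≤ r) : ∃ n : ℕ, r ≤ 2 ^ n ∧ 2 ^ n ≤ 2 * r := by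
  obtain ⟨n, hle, hlt⟩ := exists_nat_pow_near hr one_lt_two
  exact ⟨n + 1, hlt.le, by rw [pow_succ']; gcongr⟩

end GeometricScales

section Chaining

variable {α : Type*} [MeasurableSpace α] {P : Measure α} {p m : ℕ}

/-- The `L¹` norm over half-spaces of the deviation of `h` from its mean, scaled by `√m` for a
sample of size `m`. -/
def scaledDeviation (P : Measure α) (h : α → HalfSpace p → ℝ) (z : Fin m → α) : ℝ≥0∞ :=
  ENNReal.ofReal √m * eLpNorm (deviation P h z) 1 (sliceMeasure p)

lemma integral_norm_sub_le_div_two_pow_pow {ι : Type*} [PseudoMetricSpace ι]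
    {S : ι → α → EuclideanSpace ℝ (Fin p)} {L : α → ℝ} (hL : Integrable L P)
    (hLip : ∀ᵐ x ∂P, ∀ i j, ‖S i x - S j x‖ ≤ L x * dist i j) {b : ℝ}
    (hb : 16 * |∫ x, L x ∂P| ≤ b ^ 4) {i j : ι} {k : ℕ} (hij : dist i j ≤ (16 ^ k)⁻¹) :
    ∫ x, ‖S i x - S j x‖ ∂P ≤ (b / 2 ^ (k + 1)) ^ 4 := by
  calc ∫ x, ‖S i x - S j x‖ ∂P ≤ ∫ x, L x * dist i j ∂P :=
        integral_mono_of_nonneg (.of_forall fun x => norm_nonneg _) (hL.mul_const _)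
          (hLip.mono fun x hx => hx i j)
    _ ≤ b ^ 4 / 16 * (16 ^ k)⁻¹ := by
        rw [integral_mul_const]
        gcongr
        linarith [le_abs_self (∫ x, L x ∂P)]
    _ = (b / 2 ^ (k + 1)) ^ 4 := by
        rw [div_pow, ← pow_mul, mul_comm (k + 1), pow_mul, show (2 : ℝ) ^ 4 = 16 by norm_num,
          pow_succ]
        field_simp
        ring

variable [IsProbabilityMeasure P] {T T' : α → EuclideanSpace ℝ (Fin p)} {κ M β : ℝ}

lemma measurable_scaledDeviation {h : α → HalfSpace p → ℝ}
    (hh : Measurable (Function.uncurry h)) :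
    Measurable (scaledDeviation P h : (Fin m → α) → ℝ≥0∞) :=
  (measurable_eLpNorm_deviation hh).const_mul _

lemma integrable_slice (hT : Measurable T) (e : HalfSpace p) :
    Integrable (fun x => slice T x e) P :=
  .of_bound ((measurable_slice hT).comp measurable_prodMk_right).aestronglyMeasurable 1
    (.of_forall fun x => norm_slice_le_one T x e)

lemma scaledDeviation_slice_le_add (hT : Measurable T) (hT' : Measurable T') (z : Fin m → α) :
    scaledDeviation P (slice T) z
      ≤ scaledDeviation P (slice T - slice T') z + scaledDeviation P (slice T') z := by
  have hmeas {S : α → EuclideanSpace ℝ (Fin p)} (hS : Measurable S) :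
      AEStronglyMeasurable (deviation P (slice S) z) (sliceMeasure p) :=
    ((measurable_deviation (measurable_slice hS)).comp measurable_prodMk_left).aestronglyMeasurable
  rw [scaledDeviation, scaledDeviation, scaledDeviation, ← mul_add,
    deviation_sub (integrable_slice hT) (integrable_slice hT')]
  gcongr
  simpa using eLpNorm_add_le ((hmeas hT).sub (hmeas hT')) (hmeas hT') le_rfl

lemma scaledDeviation_slice_const (v : EuclideanSpace ℝ (Fin p)) (hm : 0 < m) (z : Fin m → α) :
    scaledDeviation P (slice fun _ => v) z = 0 := by
  have hzero : deviation P (slice fun _ => v) z = 0 := by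
    ext e
    simp [deviation, slice, hm.ne']
  simp [scaledDeviation, hzero]

lemma scaledDeviation_slice_sub_slice_le (hT : Measurable T) (hT' : Measurable T')
    (z : Fin m → α) :
    scaledDeviation P (slice T - slice T') z ≤ ENNReal.ofReal √m
      * ((m : ℝ≥0∞)⁻¹ * ∑ j, ‖T (z j) - T' (z j)‖ₑ + ∫⁻ x, ‖T x - T' x‖ₑ ∂P) := by
  rw [scaledDeviation]
  gcongr
  refine (eLpNorm_deviation_le ((measurable_slice hT).sub (measurable_slice hT')) z).trans ?_
  gcongr <;> exact eLpNorm_slice_sub_slice_le hT hT' _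

lemma scaledDeviation_slice_sub_slice_eq_ofReal (hκ : 0 < κ) (hT : ExpMomentLE P T (10 * κ) M)
    (hT' : ExpMomentLE P T' (10 * κ) M) (z : Fin m → α) :
    scaledDeviation P (slice T - slice T') z = ENNReal.ofReal
      (√m * (eLpNorm (deviation P (slice T - slice T') z) 1 (sliceMeasure p)).toReal) := by
  rw [ENNReal.ofReal_mul (Real.sqrt_nonneg _),
    ENNReal.ofReal_toReal (memLp_deviation_slice_sub_slice hκ hT hT' z).2.ne, scaledDeviation]

lemma logMomentBound_nonneg (hκ : 0 < κ) (hM : 0 ≤ M) : 0 ≤ logMomentBound κ M := by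
  unfold logMomentBound
  positivity

lemma lintegral_biSup_scaledDeviation_le {ι : Type*} {N : Finset ι}
    {S S' : ι → α → EuclideanSpace ℝ (Fin p)} (hκ : 0 < κ) (hβ : 0 < β) (hM : 0 ≤ M)
    (hS : ∀ i, ExpMomentLE P (S i) (10 * κ) M) (hS' : ∀ i, ExpMomentLE P (S' i) (10 * κ) M)
    (hdist : ∀ i, ∫ x, ‖S i x - S' i x‖ ∂P ≤ β ^ 4) (hm : 0 < m) (hβm : 2 * β⁻¹ ≤ κ * √m) :
    ∫⁻ z : Fin m → α, ⨆ i ∈ N, scaledDeviation P (slice (S i) - slice (S' i)) z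
        ∂(Measure.pi fun _ => P)
      ≤ ENNReal.ofReal (β * (Real.log N.card + logMomentBound κ M + 1)) := by
  simp_rw [fun i => scaledDeviation_slice_sub_slice_eq_ofReal (m := m) hκ (hS i) (hS' i)]
  exact lintegral_biSup_ofReal_le
    (fun i _ => (measurable_eLpNorm_deviation ((measurable_slice (hS i).measurable).sub
      (measurable_slice (hS' i).measurable))).ennreal_toReal.const_mul _)
    hβ (logMomentBound_nonneg hκ hM)
    fun i _ => lintegral_exp_eLpNorm_deviation_slice_le hκ hβ (hS i) (hS' i) (hdist i) hm hβm

lemma ExpMomentLE.const_zero {c : ℝ} (hM : 1 ≤ M) :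
    ExpMomentLE P (fun _ => (0 : EuclideanSpace ℝ (Fin p))) c M where
  measurable := measurable_const
  integrable := integrable_const _
  integral_le := by simpa using hM

lemma lintegral_biSup_scaledDeviation_slice_le {ι : Type*} {N : Finset ι}
    {S : ι → α → EuclideanSpace ℝ (Fin p)} (hκ : 0 < κ) (hβ : 0 < β) (hM : 1 ≤ M)
    (hS : ∀ i, ExpMomentLE P (S i) (10 * κ) M) (hMβ : M / (10 * κ) ≤ β ^ 4) (hm : 0 < m)
    (hβm : 2 * β⁻¹ ≤ κ * √m) :
    ∫⁻ z : Fin m → α, ⨆ i ∈ N, scaledDeviation P (slice (S i)) z ∂(Measure.pi fun _ => P)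
      ≤ ENNReal.ofReal (β * (Real.log N.card + logMomentBound κ M + 1)) := by
  refine (lintegral_mono fun z => iSup₂_mono fun i _ => ?_).trans
    (lintegral_biSup_scaledDeviation_le (S' := fun _ _ => 0) hκ hβ (by linarith) hS
      (fun _ => .const_zero hM) (fun i => ?_) hm hβm)
  · exact (scaledDeviation_slice_le_add (hS i).measurable measurable_const z).trans_eq
      (by rw [scaledDeviation_slice_const 0 hm z, add_zero])
  · simpa using ((hS i).integral_norm_le (by positivity)).trans hMβ

section Family

variable {ι : Type*} [PseudoMetricSpace ι] {S : ι → α → EuclideanSpace ℝ (Fin p)} {L : α → ℝ}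

lemma lintegral_biSup_net_le (hκ : 0 < κ) (hM : 1 ≤ M)
    (hS : ∀ i, ExpMomentLE P (S i) (10 * κ) M) (hL : Integrable L P)
    (hLip : ∀ᵐ x ∂P, ∀ i j, ‖S i x - S j x‖ ≤ L x * dist i j) {N : ℕ → Finset ι} {c : ℝ}
    (hc : 0 ≤ c) (hcard : ∀ k : ℕ, Real.log (N k).card ≤ c * (k + 1)) {π : ℕ → ι → ι}
    (hπ : ∀ k i, π k i ∈ N k) (hdist : ∀ k i, dist i (π k i) ≤ (16 ^ k)⁻¹) {b : ℝ}
    (hbκ : 4 / κ ≤ b) (hbL : 16 * |∫ x, L x ∂P| ≤ b ^ 4) (hbM : M / (10 * κ) ≤ b ^ 4)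
    (hm : 0 < m) {n : ℕ} (hn : 2 ^ n ≤ 2 * √m) :
    ∫⁻ z : Fin m → α, ⨆ i ∈ N n, scaledDeviation P (slice (S i)) z ∂(Measure.pi fun _ => P)
      ≤ ENNReal.ofReal (4 * (b * (c + logMomentBound κ M + 1))) := by
  have hb : 0 < b := (by positivity : 0 < 4 / κ).trans_le hbκ
  have hscale {k : ℕ} (hk : k ≤ n) : 2 * (b / 2 ^ k)⁻¹ ≤ κ * √m :=
    two_mul_inv_div_two_pow_le hκ hbκ ((pow_le_pow_right₀ one_le_two hk).trans hn)
  refine (lintegral_biSup_le_sum_range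
    (fun i => measurable_scaledDeviation (measurable_slice (hS i).measurable)) hπ
    (fun k i z => scaledDeviation_slice_le_add (hS i).measurable (hS (π k i)).measurable z)
    (a := fun k => ENNReal.ofReal
      (b / 2 ^ k * (Real.log (N k).card + logMomentBound κ M + 1))) ?_ fun k hk => ?_).trans
    (sum_range_ofReal_div_two_pow_mul_le hb.le (logMomentBound_nonneg hκ (by linarith)) hc hcard n)
  · exact lintegral_biSup_scaledDeviation_slice_le hκ (by positivity) hM hS (by simpa using hbM)
      hm (hscale n.zero_le)
  · exact lintegral_biSup_scaledDeviation_le hκ (by positivity) (by linarith) hS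
      (fun i => hS (π k i)) (fun i => integral_norm_sub_le_div_two_pow_pow hL hLip hbL (hdist k i))
      hm (hscale hk)

/-- The mean of `‖L‖ₑ` over the sample `z` plus its expectation under `P`; it bounds the change of
a deviation under a perturbation of size `‖L‖ₑ`. -/
def sampleEnvelope (P : Measure α) (L : α → ℝ) (z : Fin m → α) : ℝ≥0∞ :=
  (m : ℝ≥0∞)⁻¹ * ∑ j, ‖L (z j)‖ₑ + ∫⁻ x, ‖L x‖ₑ ∂P

lemma aemeasurable_sampleEnvelope (hL : AEStronglyMeasurable L P) :
    AEMeasurable (sampleEnvelope P L : (Fin m → α) → ℝ≥0∞) (Measure.pi fun _ => P) :=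
  ((Finset.univ.aemeasurable_fun_sum fun j _ => (hL.comp_quasiMeasurePreserving
    (Measure.quasiMeasurePreserving_eval (fun _ => P) j)).enorm).const_mul _).add_const _

lemma lintegral_sampleEnvelope_le (hL : AEStronglyMeasurable L P) :
    ∫⁻ z : Fin m → α, sampleEnvelope P L z ∂(Measure.pi fun _ => P) ≤ 2 * ∫⁻ x, ‖L x‖ₑ ∂P := by
  have hcoord (j : Fin m) : ∫⁻ z : Fin m → α, ‖L (z j)‖ₑ ∂(Measure.pi fun _ => P)
      = ∫⁻ x, ‖L x‖ₑ ∂P := by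
    have hmp := measurePreserving_eval (fun _ : Fin m => P) j
    conv_rhs => rw [← hmp.map_eq]
    exact (lintegral_map' (hmp.map_eq.symm ▸ hL.enorm) hmp.aemeasurable).symm
  have hmeas (j : Fin m) : AEMeasurable (fun z : Fin m → α => ‖L (z j)‖ₑ)
      (Measure.pi fun _ => P) :=
    (hL.comp_quasiMeasurePreserving (Measure.quasiMeasurePreserving_eval _ j)).enorm
  calc ∫⁻ z : Fin m → α, sampleEnvelope P L z ∂(Measure.pi fun _ => P)
      = (m : ℝ≥0∞)⁻¹ * (m * ∫⁻ x, ‖L x‖ₑ ∂P) + ∫⁻ x, ‖L x‖ₑ ∂P := by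
        simp only [sampleEnvelope]
        rw [lintegral_add_right _ measurable_const, lintegral_const, measure_univ, mul_one,
          lintegral_const_mul'' _ (Finset.univ.aemeasurable_fun_sum fun j _ => hmeas j),
          lintegral_finsetSum' _ fun j _ => hmeas j]
        simp [hcoord]
    _ ≤ 2 * ∫⁻ x, ‖L x‖ₑ ∂P := by
        rw [← mul_assoc, two_mul]
        gcongr
        exact mul_le_of_le_one_left' (ENNReal.inv_mul_le_one _)

lemma scaledDeviation_slice_le_sampleEnvelope_add (hT : Measurable T) (hT' : Measurable T')
    {δ : ℝ} (hδ0 : 0 ≤ δ) (hδ : √m * δ ≤ 1) {z : Fin m → α}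
    (hz : ∀ j, ‖T (z j) - T' (z j)‖ ≤ ‖L (z j)‖ * δ)
    (hP : ∀ᵐ x ∂P, ‖T x - T' x‖ ≤ ‖L x‖ * δ) :
    scaledDeviation P (slice T) z ≤ sampleEnvelope P L z + scaledDeviation P (slice T') z := by
  have henorm {x : α} (hx : ‖T x - T' x‖ ≤ ‖L x‖ * δ) :
      ‖T x - T' x‖ₑ ≤ ‖L x‖ₑ * ENNReal.ofReal δ := by
    rwa [← Real.enorm_of_nonneg hδ0, ← enorm_mul, enorm_le_iff_norm_le, norm_mul,
      Real.norm_of_nonneg hδ0]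
  refine (scaledDeviation_slice_le_add hT hT' z).trans (add_le_add_left ?_ _)
  calc scaledDeviation P (slice T - slice T') z
      ≤ ENNReal.ofReal √m
        * ((m : ℝ≥0∞)⁻¹ * ∑ j, ‖T (z j) - T' (z j)‖ₑ + ∫⁻ x, ‖T x - T' x‖ₑ ∂P) :=
        scaledDeviation_slice_sub_slice_le hT hT' z
    _ ≤ ENNReal.ofReal √m * ((m : ℝ≥0∞)⁻¹ * ∑ j, ‖L (z j)‖ₑ * ENNReal.ofReal δ
        + ∫⁻ x, ‖L x‖ₑ * ENNReal.ofReal δ ∂P) := by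
        refine mul_le_mul_right (add_le_add (mul_le_mul_right ?_ _) ?_) _
        · exact Finset.sum_le_sum fun j _ => henorm (hz j)
        · exact lintegral_mono_ae (hP.mono fun x hx => henorm hx)
    _ = ENNReal.ofReal (√m * δ) * sampleEnvelope P L z := by
        rw [← Finset.sum_mul, lintegral_mul_const' _ _ ENNReal.ofReal_ne_top, sampleEnvelope,
          ENNReal.ofReal_mul (Real.sqrt_nonneg _)]
        ring
    _ ≤ sampleEnvelope P L z := mul_le_of_le_one_left' (ENNReal.ofReal_le_one.2 hδ)

lemma ae_scaledDeviation_le_sampleEnvelope_add_biSup (hS : ∀ i, Measurable (S i))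
    (hLip : ∀ᵐ x ∂P, ∀ i j, ‖S i x - S j x‖ ≤ L x * dist i j) {N : Finset ι} {π : ι → ι}
    (hπ : ∀ i, π i ∈ N) {δ : ℝ} (hδ0 : 0 ≤ δ) (hδ : √m * δ ≤ 1) (hdist : ∀ i, dist i (π i) ≤ δ) :
    ∀ᵐ z : Fin m → α ∂(Measure.pi fun _ => P), ∀ i, scaledDeviation P (slice (S i)) z
      ≤ sampleEnvelope P L z + ⨆ i ∈ N, scaledDeviation P (slice (S i)) z := by
  have hnear : ∀ᵐ x ∂P, ∀ i, ‖S i x - S (π i) x‖ ≤ ‖L x‖ * δ :=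
    hLip.mono fun x hx i => (hx i _).trans
      (mul_le_mul (le_abs_self _) (hdist i) dist_nonneg (norm_nonneg _))
  have hsample : ∀ᵐ z : Fin m → α ∂(Measure.pi fun _ => P), ∀ j i,
      ‖S i (z j) - S (π i) (z j)‖ ≤ ‖L (z j)‖ * δ :=
    ae_all_iff.2 fun j => (Measure.quasiMeasurePreserving_eval (fun _ => P) j).ae hnear
  filter_upwards [hsample] with z hz i
  calc scaledDeviation P (slice (S i)) z
      ≤ sampleEnvelope P L z + scaledDeviation P (slice (S (π i))) z :=
        scaledDeviation_slice_le_sampleEnvelope_add (hS i) (hS (π i)) hδ0 hδ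
          (fun j => hz j i) (hnear.mono fun x hx => hx i)
    _ ≤ sampleEnvelope P L z + ⨆ i ∈ N, scaledDeviation P (slice (S i)) z :=
        add_le_add_right
          (le_iSup₂ (f := fun i _ => scaledDeviation P (slice (S i)) z) (π i) (hπ i)) _

theorem exists_majorant_scaledDeviation_of_nets (hκ : 0 < κ) (hM : 1 ≤ M)
    (hS : ∀ i, ExpMomentLE P (S i) (10 * κ) M) (hL : Integrable L P)
    (hLip : ∀ᵐ x ∂P, ∀ i j, ‖S i x - S j x‖ ≤ L x * dist i j) {c : ℝ} (hc : 0 ≤ c)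
    (hnets : ∀ k : ℕ, ∃ N : Finset ι, Real.log N.card ≤ c * (k + 1) ∧
      ∀ i, ∃ j ∈ N, dist i j ≤ (16 ^ k)⁻¹) :
    ∃ B : ℝ≥0, ∀ m, 0 < m → ∃ R : (Fin m → α) → ℝ≥0∞,
      AEMeasurable R (Measure.pi fun _ => P) ∧ ∫⁻ z, R z ∂(Measure.pi fun _ => P) ≤ B ∧
      ∀ᵐ z ∂(Measure.pi fun _ => P), ∀ i, scaledDeviation P (slice (S i)) z ≤ R z := by
  choose N hcard hN using hnets
  choose π hπ hdist using hN
  set b : ℝ := 1 + 4 / κ + 16 * |∫ x, L x ∂P| + M / (10 * κ)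
  have hκ4 : 0 ≤ 4 / κ := by positivity
  have hL0 : 0 ≤ 16 * |∫ x, L x ∂P| := by positivity
  have hM0 : 0 ≤ M / (10 * κ) := by positivity
  have hb4 : b ≤ b ^ 4 := le_self_pow₀ (by linarith) (by norm_num)
  refine ⟨2 * (∫⁻ x, ‖L x‖ₑ ∂P).toNNReal
    + (4 * (b * (c + logMomentBound κ M + 1))).toNNReal, fun m hm => ?_⟩
  obtain ⟨n, hn, hn'⟩ := exists_two_pow_near (r := √m) (Real.one_le_sqrt.2 (mod_cast hm))
  have hδ : √m * (16 ^ n)⁻¹ ≤ 1 := by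
    rw [← div_eq_mul_inv, div_le_one (by positivity)]
    exact hn.trans (pow_le_pow_left₀ zero_le_two (by norm_num) n)
  have hnet : Measurable fun z : Fin m → α => ⨆ i ∈ N n, scaledDeviation P (slice (S i)) z :=
    .biSup _ (N n).countable_toSet fun i _ =>
      measurable_scaledDeviation (measurable_slice (hS i).measurable)
  refine ⟨fun z => sampleEnvelope P L z + ⨆ i ∈ N n, scaledDeviation P (slice (S i)) z,
    (aemeasurable_sampleEnvelope hL.1).add hnet.aemeasurable, ?_,
    ae_scaledDeviation_le_sampleEnvelope_add_biSup (fun i => (hS i).measurable) hLip (hπ n)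
      (by positivity) hδ (hdist n)⟩
  rw [lintegral_add_right _ hnet]
  push_cast
  rw [ENNReal.coe_toNNReal hL.2.ne]
  exact add_le_add (lintegral_sampleEnvelope_le hL.1)
    (lintegral_biSup_net_le hκ hM hS hL hLip hc hcard hπ hdist (by linarith) (by linarith)
      (by linarith) hm hn')

end Family

end Chaining

section SubGaussian

variable {α : Type*} [MeasurableSpace α] {P : Measure α} {p : ℕ}

lemma lintegral_exp_sq_le_of_psi2Norm_le {ν : Measure ℝ} {K : ℝ≥0} (h : psi2Norm ν ≤ K) :
    ∫⁻ y, ENNReal.ofReal (Real.exp (y ^ 2 / (K + 1) ^ 2)) ∂ν ≤ 2 := by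
  have hlt : psi2Norm ν < (K + 1 : ℝ≥0) := h.trans_lt (mod_cast lt_add_one K)
  simp only [psi2Norm, iInf_lt_iff] at hlt
  obtain ⟨K₀, ⟨hK₀, hint⟩, hK⟩ := hlt
  have hK' : (K₀ : ℝ) ≤ K + 1 := mod_cast hK.le
  have : (0 : ℝ) < K₀ := mod_cast hK₀
  refine (lintegral_mono fun y => ?_).trans hint
  gcongr

lemma lintegral_exp_sq_coord_le {T : α → EuclideanSpace ℝ (Fin p)} (hT : Measurable T) {K : ℝ≥0}
    (h : psi2NormVec (P.map T) ≤ K) (i : Fin p) :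
    ∫⁻ x, ENNReal.ofReal (Real.exp (T x i ^ 2 / (K + 1) ^ 2)) ∂P ≤ 2 := by
  have hunit : EuclideanSpace.single i (1 : ℝ)
      ∈ Metric.sphere (0 : EuclideanSpace ℝ (Fin p)) 1 := by simp
  have hnorm : psi2Norm (proj (P.map T) (EuclideanSpace.single i 1)) ≤ K :=
    (le_iSup (fun ω : Metric.sphere (0 : EuclideanSpace ℝ (Fin p)) 1 =>
      psi2Norm (proj (P.map T) ω)) ⟨_, hunit⟩).trans h
  have hinner : Measurable fun x : EuclideanSpace ℝ (Fin p) =>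
      inner ℝ (EuclideanSpace.single i (1 : ℝ)) x := by fun_prop
  have hcoord := lintegral_exp_sq_le_of_psi2Norm_le hnorm
  rw [proj, lintegral_map (by fun_prop) hinner, lintegral_map (by fun_prop) hT] at hcoord
  simpa [EuclideanSpace.inner_single_left] using hcoord

lemma exp_sq_norm_div_le_inv_mul_sum [NeZero p] (v : EuclideanSpace ℝ (Fin p)) (r : ℝ) :
    Real.exp (‖v‖ ^ 2 / (p * r)) ≤ (p : ℝ)⁻¹ * ∑ i, Real.exp (v i ^ 2 / r) := by
  have hp : (p : ℝ) ≠ 0 := NeZero.ne _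
  have hjensen := convexOn_exp.map_sum_le (t := Finset.univ) (w := fun _ : Fin p => (p : ℝ)⁻¹)
    (p := fun i => v i ^ 2 / r) (fun _ _ => by positivity) (by simp [hp]) (by simp)
  simp only [smul_eq_mul, ← Finset.mul_sum, ← Finset.sum_div] at hjensen
  refine (Real.exp_le_exp.2 (le_of_eq ?_)).trans hjensen
  rw [EuclideanSpace.real_norm_sq_eq]
  field_simp

lemma lintegral_exp_sq_norm_le_two [NeZero p] {T : α → EuclideanSpace ℝ (Fin p)}
    (hT : Measurable T) {K : ℝ≥0} (h : psi2NormVec (P.map T) ≤ K) :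
    ∫⁻ x, ENNReal.ofReal (Real.exp (‖T x‖ ^ 2 / (p * (K + 1) ^ 2))) ∂P ≤ 2 := by
  calc ∫⁻ x, ENNReal.ofReal (Real.exp (‖T x‖ ^ 2 / (p * (K + 1) ^ 2))) ∂P
      ≤ ∫⁻ x, (p : ℝ≥0∞)⁻¹ * ∑ i, ENNReal.ofReal (Real.exp (T x i ^ 2 / (K + 1) ^ 2)) ∂P := by
        refine lintegral_mono fun x => ?_
        rw [← ENNReal.ofReal_sum_of_nonneg fun i _ => (Real.exp_pos _).le, ← ENNReal.ofReal_natCast,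
          ← ENNReal.ofReal_inv_of_pos (mod_cast NeZero.pos p), ← ENNReal.ofReal_mul (by positivity)]
        exact ENNReal.ofReal_le_ofReal (exp_sq_norm_div_le_inv_mul_sum _ _)
    _ = (p : ℝ≥0∞)⁻¹ * ∑ i, ∫⁻ x, ENNReal.ofReal (Real.exp (T x i ^ 2 / (K + 1) ^ 2)) ∂P := by
        rw [lintegral_const_mul _ (by fun_prop), lintegral_finsetSum _ fun i _ => by fun_prop]
    _ ≤ (p : ℝ≥0∞)⁻¹ * ∑ _i : Fin p, 2 := by
        gcongr with i
        exact lintegral_exp_sq_coord_le hT h i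
    _ = 2 := by
        rw [Finset.sum_const, Finset.card_univ, Fintype.card_fin, nsmul_eq_mul, ← mul_assoc,
          ENNReal.inv_mul_cancel (by exact_mod_cast NeZero.ne p) (ENNReal.natCast_ne_top p),
          one_mul]

lemma lintegral_exp_norm_le_of_psi2NormVec_le [IsProbabilityMeasure P]
    {T : α → EuclideanSpace ℝ (Fin p)} (hT : Measurable T) {K : ℝ≥0}
    (h : psi2NormVec (P.map T) ≤ K) :
    ∫⁻ x, ENNReal.ofReal (Real.exp ‖T x‖) ∂P
      ≤ ENNReal.ofReal (Real.exp (p * (K + 1) ^ 2 / 4)) * 2 := by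
  rcases p.eq_zero_or_pos with rfl | hp
  · simp [Subsingleton.elim _ (0 : EuclideanSpace ℝ (Fin 0))]
  have := NeZero.of_pos hp
  calc ∫⁻ x, ENNReal.ofReal (Real.exp ‖T x‖) ∂P
      ≤ ∫⁻ x, ENNReal.ofReal (Real.exp (p * (K + 1) ^ 2 / 4))
          * ENNReal.ofReal (Real.exp (‖T x‖ ^ 2 / (p * (K + 1) ^ 2))) ∂P := by
        refine lintegral_mono fun x => ?_
        rw [← ENNReal.ofReal_mul (Real.exp_pos _).le, ← Real.exp_add]
        gcongr
        rw [← sub_nonneg]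
        refine (by positivity : 0 ≤ (‖T x‖ - p * (K + 1) ^ 2 / 2) ^ 2 / (p * (K + 1) ^ 2)).trans_eq
          ?_
        field_simp
        ring
    _ ≤ ENNReal.ofReal (Real.exp (p * (K + 1) ^ 2 / 4)) * 2 := by
        rw [lintegral_const_mul' _ _ ENNReal.ofReal_ne_top]
        gcongr
        exact lintegral_exp_sq_norm_le_two hT h

end SubGaussian

lemma isBigOp_of_mul_le {Ω : ℕ → Type*} [∀ m, MeasurableSpace (Ω m)] {μ : ∀ m, Measure (Ω m)}
    {X R : ∀ m, Ω m → ℝ≥0∞} {a : ℕ → ℝ} (ha : ∀ m, 1 ≤ m → 0 < a m) {B : ℝ≥0}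
    (hR : ∀ m, 1 ≤ m → AEMeasurable (R m) (μ m)) (hB : ∀ m, 1 ≤ m → ∫⁻ z, R m z ∂(μ m) ≤ B)
    (hX : ∀ m, 1 ≤ m → ∀ᵐ z ∂(μ m), X m z ≤ ENNReal.ofReal (a m) * R m z) :
    IsBigOp μ X a := by
  intro ε hε
  refine ⟨(B + 1) / ε, by positivity, fun m hm => ?_⟩
  have ha0 : ENNReal.ofReal (a m) ≠ 0 := (ENNReal.ofReal_pos.2 (ha m hm)).ne'
  calc μ m {z | ENNReal.ofReal ((B + 1) / ε * a m) < X m z}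
      ≤ μ m {z | ENNReal.ofReal ((B + 1) / ε) ≤ R m z} := by
        refine measure_mono_ae ((hX m hm).mono fun z hz (hlt : _ < X m z) => ?_)
        rw [mul_comm, ENNReal.ofReal_mul (ha m hm).le] at hlt
        exact (ENNReal.mul_le_mul_iff_right ha0 ENNReal.ofReal_ne_top).1 (hlt.le.trans hz)
    _ ≤ (∫⁻ z, R m z ∂(μ m)) / ENNReal.ofReal ((B + 1) / ε) :=
        meas_ge_le_lintegral_div (hR m hm) (ENNReal.ofReal_pos.2 (by positivity)).ne'
          ENNReal.ofReal_ne_top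
    _ ≤ ENNReal.ofReal (B + 1) / ENNReal.ofReal ((B + 1) / ε) := by
        gcongr
        exact (hB m hm).trans (by simp [ENNReal.ofReal_add])
    _ = ENNReal.ofReal ε := by
        rw [← ENNReal.ofReal_div_of_pos (by positivity), div_div_cancel₀ (by positivity)]

lemma ExpMomentLE.of_lintegral_le {α : Type*} [MeasurableSpace α] {P : Measure α} {p : ℕ}
    {T : α → EuclideanSpace ℝ (Fin p)} (hT : Measurable T) {s : ℝ} {M : ℝ≥0}
    (h : ∫⁻ x, ENNReal.ofReal (Real.exp (s * ‖T x‖)) ∂P ≤ M) :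
    ExpMomentLE P T s M where
  measurable := hT
  integrable := ⟨by fun_prop, by
    rw [hasFiniteIntegral_iff_ofReal (.of_forall fun x => (Real.exp_pos _).le)]
    exact h.trans_lt ENNReal.coe_lt_top⟩
  integral_le := by
    rw [integral_eq_lintegral_of_nonneg_ae (.of_forall fun x => (Real.exp_pos _).le)
      (by fun_prop)]
    exact ENNReal.toReal_le_coe_of_le_coe h

lemma slicedW_le_rpow_mul_scaledDeviation {α : Type*} [MeasurableSpace α] {P : Measure α}
    [IsProbabilityMeasure P] {p m : ℕ} (hm : 0 < m) {T : α → EuclideanSpace ℝ (Fin p)}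
    (hT : Measurable T) (z : Fin m → α) :
    slicedW (empirical fun j => T (z j)) (P.map T)
      ≤ ENNReal.ofReal ((m : ℝ) ^ (-(1 / 2) : ℝ)) * scaledDeviation P (slice T) z := by
  have hm' : (0 : ℝ) < m := mod_cast hm
  refine (slicedW_empirical_le_eLpNorm_deviation hm hT z).trans_eq ?_
  rw [scaledDeviation, ← mul_assoc, ← ENNReal.ofReal_mul (by positivity), Real.sqrt_eq_rpow,
    ← Real.rpow_add hm', neg_add_cancel, Real.rpow_zero, ENNReal.ofReal_one, one_mul]

end SlicedW

end

theorem mainTheorem6_general {F : Type*} [NormedAddCommGroup F] [NormedSpace ℝ F]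
    [FiniteDimensional ℝ F] {p : ℕ} {𝒵 : Type*} [MeasurableSpace 𝒵]
    (PZ : Measure 𝒵) [IsProbabilityMeasure PZ]
    (Θ : Set F) (hΘ : Bornology.IsBounded Θ)
    (τ : F → 𝒵 → EuclideanSpace ℝ (Fin p)) (hτ : ∀ θ ∈ Θ, Measurable (τ θ))
    (L : 𝒵 → ℝ) (hL : Integrable L PZ)
    (hLip : ∀ᵐ z ∂PZ, ∀ θ₁ ∈ Θ, ∀ θ₂ ∈ Θ, ‖τ θ₁ z - τ θ₂ z‖ ≤ L z * ‖θ₁ - θ₂‖)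
    {s : ℝ} (hs : 0 < s) (M : ℝ≥0)
    (hexp : ∀ θ ∈ Θ, ∫⁻ z, ENNReal.ofReal (Real.exp (s * ‖τ θ z‖)) ∂PZ ≤ M) :
    SlicedW.IsBigOp (fun m => Measure.pi (fun _ : Fin m => PZ))
      (fun m z => ⨆ θ ∈ Θ,
        SlicedW.slicedW (SlicedW.empirical (fun j : Fin m => τ θ (z j))) (PZ.map (τ θ)))
      (fun m => (m : ℝ) ^ (-(1 / 2) : ℝ)) := by
  obtain ⟨c, hc, hnets⟩ := SlicedW.exists_geometric_nets hΘ (q := 16) (by norm_num)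
  have hS (θ : Θ) : SlicedW.ExpMomentLE PZ (τ θ) (10 * (s / 10)) (max 1 M : ℝ≥0) := by
    refine .of_lintegral_le (hτ θ θ.2) ?_
    rw [mul_div_cancel₀ s (by norm_num)]
    exact (hexp θ θ.2).trans (mod_cast le_max_right 1 M)
  obtain ⟨B, hB⟩ := SlicedW.exists_majorant_scaledDeviation_of_nets (div_pos hs (by norm_num))
    (mod_cast le_max_left 1 M) hS hL
    (hLip.mono fun z hz θ₁ θ₂ => (hz θ₁ θ₁.2 θ₂ θ₂.2).trans_eq
      (by rw [Subtype.dist_eq, dist_eq_norm])) hc hnets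
  choose! R hmeas hint hle using hB
  refine SlicedW.isBigOp_of_mul_le (fun m hm => Real.rpow_pos_of_pos (mod_cast hm) _) hmeas hint
    fun m hm => (hle m hm).mono fun z hz => iSup₂_le fun θ hθ => ?_
  exact (SlicedW.slicedW_le_rpow_mul_scaledDeviation hm (hτ θ hθ) z).trans
    (mul_le_mul_right (hz ⟨θ, hθ⟩) _)

theorem mainTheorem6 {d p : ℕ} {𝒵 : Type*} [MeasurableSpace 𝒵]
    (PZ : Measure 𝒵) [IsProbabilityMeasure PZ]
    (Θ : Set (EuclideanSpace ℝ (Fin d))) (hΘ : IsCompact Θ)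
    (τ : EuclideanSpace ℝ (Fin d) → 𝒵 → EuclideanSpace ℝ (Fin p))
    (hτ : ∀ θ ∈ Θ, Measurable (τ θ))
    (L : 𝒵 → ℝ) (hL : Integrable L PZ)
    (hLip : ∀ᵐ z ∂PZ, ∀ θ₁ ∈ Θ, ∀ θ₂ ∈ Θ, ‖τ θ₁ z - τ θ₂ z‖ ≤ L z * ‖θ₁ - θ₂‖)
    (K : ℝ≥0) (hsub : ∀ θ ∈ Θ, SlicedW.psi2NormVec (PZ.map (τ θ)) ≤ K) :
    SlicedW.IsBigOp (fun m => Measure.pi (fun _ : Fin m => PZ))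
      (fun m z => ⨆ θ ∈ Θ,
        SlicedW.slicedW (SlicedW.empirical (fun j : Fin m => τ θ (z j))) (PZ.map (τ θ)))
      (fun m => (m : ℝ) ^ (-(1 / 2) : ℝ)) := by
  exact mainTheorem6_general PZ Θ hΘ.isBounded τ hτ L hL hLip one_pos
    (Real.toNNReal (Real.exp (p * (K + 1) ^ 2 / 4)) * 2) fun θ hθ => by
      simpa [ENNReal.ofReal] using
        SlicedW.lintegral_exp_norm_le_of_psi2NormVec_le (hτ θ hθ) (hsub θ hθ)
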